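/- Let $Y$ be a real Banach space, with dual $Y^*$. A sequence in a dual space is weak$^*$-null if it converges to $0$ in the weak$^*$ topology. A subset $A$ of a Banach space $X$ is called limited if $\lim_{n\to\infty}\sup_{x\in A}|\langle p_n,x\rangle|=0$ for every weak$^*$-null sequence $(p_n)_n$ in $X^*$; a bounded linear operator $T:Y\to X$ is called limited if $T(B_Y)$ is a limited subset of $X$, where $B_Y$ is the closed unit ball of $Y$. For $K\subset Y^*$, a function $g:K\to\mathbb{R}$ has a norm-strong (respectively weak$^*$-strong) minimum at $a\in K$ if $g(a)=\inf_K g$ and every sequence $(p_n)_n$ in $K$ with $g(p_n)\to g(a)$ converges to $a$ in norm (respectively weak$^*$). Then the following assertions are equivalent. (1) $Y$ is infinite dimensional. (2) There is a weak$^*$-null sequence $(p_n)_n$ in $Y^*$ with $\inf_n\|p_n\|>0$ (a JN-sequence). (3) There are a convex, norm-separable, weak$^*$-compact and weak$^*$-metrizable subset $K$ of $Y^*$ containing $0$ and a norm-continuous seminorm $h$ on $Y^*$ which is weak$^*$ lower semicontinuous and weak$^*$ sequentially continuous, such that the restriction $h|_K$ has a weak$^*$-strong minimum but not a norm-strong minimum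 at $0$. (4) There are a Banach space $X$ and a bounded linear operator $T:Y\to X$ that is not limited. (5) There is a convex continuous function $f:Y\to\mathbb{R}$ which at some point of $Y$ is Gâteaux differentiable (with a continuous linear Gâteaux derivative) but not Fréchet differentiable. -/

import Mathlib

open Filter Topology

universe u v

/-- `(pₙ)` in the dual `X*` is weak*-null: it converges to `0` in the weak* topology. -/
def IsWeakStarNull {X : Type*} [NormedAddCommGroup X] [NormedSpace ℝ X]
    (p : ℕ → StrongDual ℝ X) : Prop :=
  Tendsto (fun n => StrongDual.toWeakDual (p n)) atTop (𝓝 0)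

/-- A JN-sequence: a weak*-null sequence in the dual with `infₙ ‖pₙ‖ > 0`. -/
def IsJNSequence {X : Type*} [NormedAddCommGroup X] [NormedSpace ℝ X]
    (p : ℕ → StrongDual ℝ X) : Prop :=
  IsWeakStarNull p ∧ 0 < ⨅ n, ‖p n‖

/-- `A` is limited: every weak*-null sequence in the dual converges to `0` uniformly on `A`. -/
def IsLimitedSet {X : Type*} [NormedAddCommGroup X] [NormedSpace ℝ X] (A : Set X) : Prop :=
  ∀ p : ℕ → StrongDual ℝ X, IsWeakStarNull p →
    TendstoUniformlyOn (fun n x => p n x) (fun _ => 0) atTop A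

/-- `T` is a limited operator: the image of the closed unit ball is a limited set. -/
def IsLimitedOperator {Y X : Type*} [NormedAddCommGroup Y] [NormedSpace ℝ Y]
    [NormedAddCommGroup X] [NormedSpace ℝ X] (T : Y →L[ℝ] X) : Prop :=
  IsLimitedSet (T '' Metric.closedBall 0 1)

/-- The restriction of `g` to `K` has a strong minimum at `a`, for the topology of `α`:
`g` attains its minimum over `K` at `a`, and every minimizing sequence in `K` converges to `a`. -/
def HasStrongMinOn {α : Type*} [TopologicalSpace α] (g : α → ℝ) (K : Set α) (a : α) : Prop :=
  a ∈ K ∧ IsMinOn g K a ∧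
    ∀ p : ℕ → α, (∀ n, p n ∈ K) → Tendsto (fun n => g (p n)) atTop (𝓝 (g a)) →
      Tendsto p atTop (𝓝 a)

/-- A subset of the dual, regarded as a subset of the dual with its weak* topology. -/
def weakStarSet {Y : Type*} [NormedAddCommGroup Y] [NormedSpace ℝ Y]
    (K : Set (StrongDual ℝ Y)) : Set (WeakDual ℝ Y) :=
  WeakDual.toStrongDual ⁻¹' K

/-- A function on the dual, regarded as a function on the dual with its weak* topology. -/
noncomputable def weakStarFun {Y : Type*} [NormedAddCommGroup Y] [NormedSpace ℝ Y]
    (h : StrongDual ℝ Y → ℝ) : WeakDual ℝ Y → ℝ :=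
  fun p => h (WeakDual.toStrongDual p)

/-- Gâteaux differentiability at `y`: there is a continuous linear functional `Q` such that
`(f (y + t v) - f y) / t → Q v` as `t → 0`, for every direction `v`. -/
def GateauxDifferentiableAt {Y : Type*} [NormedAddCommGroup Y] [NormedSpace ℝ Y]
    (f : Y → ℝ) (y : Y) : Prop :=
  ∃ Q : StrongDual ℝ Y, ∀ v : Y, HasLineDerivAt ℝ f (Q v) y v

/-- A PGNF-function: at some point it is Gâteaux but not Fréchet differentiable. -/
def IsPGNF {Y : Type*} [NormedAddCommGroup Y] [NormedSpace ℝ Y] (f : Y → ℝ) : Prop :=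
  ∃ y : Y, GateauxDifferentiableAt f y ∧ ¬ DifferentiableAt ℝ f y

/-! The heart is the implication from infinite dimension to a JN-sequence (the Josefson–Nissenzweig
theorem); the other conditions follow from such a sequence by explicit constructions, and each fails
in finite dimension because there the weak* and norm topologies of the dual agree.

For Josefson–Nissenzweig, Riesz's lemma gives a bounded 1-separated sequence in `Y*`. By Rosenthal's
dichotomy (`exists_pointwise_tendsto_or_lower_l1`), some subsequence either converges pointwise, and
consecutive differences form a JN-sequence, or satisfies a lower `ℓ¹`-estimate. The dichotomy rests
on the Nash-Williams theorem, which turns oscillation along every subsequence into alternation on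
all finite subsets of one infinite set.

In the `ℓ¹` case, following Hagler and Johnson, one passes to normalised tail combinations `z` of
the basis whose optimal pointwise limsup bound `δ` on the unit ball cannot be lowered by further
combinations. If `δ = 0`, the images of `z` form a JN-sequence. If `δ > 0`, testing averages of
signed `z n` shows that one point of the ball can split finitely many infinite index sets
simultaneously. Iterating gives points `x i` on which uniformly bounded functionals realise every
sign pattern. Averaging these against Rademacher signs and passing to weak* limits gives functionals
`q i` with `q i (x i) ≥ ε`, while Bessel's inequality makes `∑ (q i y)²` finite, so `q` is
weak*-null.

From a JN-sequence `p`: the infinite convex combinations of `p` and `0` form `K`, and `∑ 2⁻ⁿ |q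
(xₙ)|`, with `x` separating the closed span of `p`, is the seminorm. The identity of `Y` is not
limited. The function `supₙ (pₙ y - 1/(n+1))⁺` is Gâteaux but not Fréchet differentiable at `0`. -/

/-! ### Ramsey theory: the Nash-Williams partition theorem. -/

/-- Fusion: a hereditary property of pairs `(n, N)` that can be achieved inside every infinite
subset of `M` holds for all `(n, D ∩ (n, ∞))`, `n ∈ D`, for some infinite `D ⊆ M`. -/
theorem exists_infinite_fusion {Q : ℕ → Set ℕ → Prop}
    (mono : ∀ n N N', N' ⊆ N → Q n N → Q n N') {M : Set ℕ} (hM : M.Infinite)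
    (h : ∀ n, ∀ L ⊆ M, L.Infinite → ∃ N ⊆ L, N.Infinite ∧ Q n N) :
    ∃ D ⊆ M, D.Infinite ∧ ∀ n ∈ D, Q n (D ∩ Set.Ioi n) := by
  have h' : ∀ L : {L : Set ℕ // L ⊆ M ∧ L.Infinite}, ∃ N : {L : Set ℕ // L ⊆ M ∧ L.Infinite},
      N.1 ⊆ L.1 ∩ Set.Ioi (sInf L.1) ∧ Q (sInf L.1) N.1 := by
    rintro ⟨L, hLM, hL⟩
    obtain ⟨N, hNL, hN, hQ⟩ := h (sInf L) L hLM hL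
    refine ⟨⟨N ∩ Set.Ioi (sInf L), fun x hx => hLM (hNL hx.1), ?_⟩,
      fun x hx => ⟨hNL hx.1, hx.2⟩, mono _ _ _ Set.inter_subset_left hQ⟩
    have := hN.sdiff (Set.finite_Iic (sInf L))
    refine this.mono fun x hx => ⟨hx.1, ?_⟩
    simpa using hx.2
  choose step hstep hQ using h'
  let s : ℕ → {L : Set ℕ // L ⊆ M ∧ L.Infinite} :=
    fun k => Nat.rec ⟨M, subset_rfl, hM⟩ (fun _ L => step L) k
  have hs : ∀ k, s (k + 1) = step (s k) := fun k => rfl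
  -- All later minima lie in `s (k + 1)`, on which `Q (d k)` holds.
  let d : ℕ → ℕ := fun k => sInf (s k).1
  have hd : ∀ k, d k ∈ (s k).1 := fun k => Nat.sInf_mem (s k).2.2.nonempty
  have hanti : Antitone fun k => (s k).1 :=
    antitone_nat_of_succ_le fun k x hx => (hstep (s k) (by rwa [hs] at hx)).1
  have hmono : StrictMono d := strictMono_nat_of_lt_succ fun k =>
    (hstep (s k) (by rw [← hs]; exact hd (k + 1))).2
  refine ⟨Set.range d, ?_, Set.infinite_range_of_injective hmono.injective, ?_⟩
  · rintro _ ⟨k, rfl⟩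
    exact (s k).2.1 (hd k)
  · rintro _ ⟨k, rfl⟩
    refine mono _ _ _ ?_ (hQ (s k))
    rintro _ ⟨⟨j, rfl⟩, hj⟩
    have hkj : k < j := hmono.lt_iff_lt.1 hj
    rw [← hs]
    exact hanti hkj (hd j)

open Classical in
/-- Every infinite subset of `M` beyond `F` has an initial segment which, joined to `F`,
belongs to `𝓕`. -/
def NashWilliamsAccepts (𝓕 : Set (Finset ℕ)) (M : Set ℕ) (F : Finset ℕ) : Prop :=
  ∀ L ⊆ M, L.Infinite → (∀ a ∈ F, ∀ b ∈ L, a < b) →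
    ∃ n, F ∪ (Finset.range n).filter (· ∈ L) ∈ 𝓕

/-- No infinite subset of `M` accepts `F`. -/
def NashWilliamsRejects (𝓕 : Set (Finset ℕ)) (M : Set ℕ) (F : Finset ℕ) : Prop :=
  ∀ N ⊆ M, N.Infinite → ¬ NashWilliamsAccepts 𝓕 N F

theorem NashWilliamsAccepts.mono {𝓕 : Set (Finset ℕ)} {M N : Set ℕ} {F : Finset ℕ}
    (h : NashWilliamsAccepts 𝓕 M F) (hN : N ⊆ M) : NashWilliamsAccepts 𝓕 N F :=
  fun L hL => h L (hL.trans hN)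

theorem NashWilliamsRejects.mono {𝓕 : Set (Finset ℕ)} {M N : Set ℕ} {F : Finset ℕ}
    (h : NashWilliamsRejects 𝓕 M F) (hN : N ⊆ M) : NashWilliamsRejects 𝓕 N F :=
  fun L hL => h L (hL.trans hN)

theorem infinite_inter_Ioi {N : Set ℕ} (hN : N.Infinite) (n : ℕ) : (N ∩ Set.Ioi n).Infinite :=
  (hN.sdiff (Set.finite_Iic n)).mono fun x hx => ⟨hx.1, by simpa using hx.2⟩

theorem exists_infinite_decides (𝓕 : Set (Finset ℕ)) (𝒢 : Finset (Finset ℕ)) {M : Set ℕ}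
    (hM : M.Infinite) : ∃ N ⊆ M, N.Infinite ∧
      ∀ F ∈ 𝒢, NashWilliamsAccepts 𝓕 N F ∨ NashWilliamsRejects 𝓕 N F := by
  classical
  induction 𝒢 using Finset.induction_on with
  | empty => exact ⟨M, subset_rfl, hM, by simp⟩
  | insert F 𝒢 _ ih =>
    obtain ⟨N, hNM, hN, h⟩ := ih
    by_cases hF : NashWilliamsRejects 𝓕 N F
    · exact ⟨N, hNM, hN, by simpa [hF] using h⟩
    · simp only [NashWilliamsRejects, not_forall, not_not] at hF
      obtain ⟨N', hN', hinf, hacc⟩ := hF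
      refine ⟨N', hN'.trans hNM, hinf, ?_⟩
      intro G hG
      rcases Finset.mem_insert.1 hG with rfl | hG
      · exact Or.inl hacc
      · exact (h G hG).imp (·.mono hN') (·.mono hN')

theorem exists_infinite_decides_all (𝓕 : Set (Finset ℕ)) : ∃ D : Set ℕ, D.Infinite ∧
    ∀ F : Finset ℕ, (F : Set ℕ) ⊆ D →
      NashWilliamsAccepts 𝓕 D F ∨ NashWilliamsRejects 𝓕 D F := by
  -- The empty set has no maximum, so the fusion does not reach it and it is decided beforehand. For
  -- nonempty `F`, only the part of `D` beyond `max F` matters.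
  obtain ⟨M, -, hM, hM0⟩ := exists_infinite_decides 𝓕 {∅} Set.infinite_univ
  obtain ⟨D, hDM, hD, hdec⟩ := exists_infinite_fusion
    (Q := fun n N => ∀ F ∈ (Finset.range (n + 1)).powerset,
      NashWilliamsAccepts 𝓕 N F ∨ NashWilliamsRejects 𝓕 N F)
    (fun n N N' hN h F hF => (h F hF).imp (·.mono hN) (·.mono hN)) hM
    (fun n L _ hL => exists_infinite_decides 𝓕 _ hL)
  refine ⟨D, hD, fun F hF => ?_⟩
  rcases F.eq_empty_or_nonempty with rfl | hne
  · exact (hM0 ∅ (by simp)).imp (·.mono hDM) (·.mono hDM)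
  · have hmax := F.max'_mem hne
    refine (hdec (F.max' hne) (hF hmax) F ?_).imp (fun h L hL hinf hlt => ?_)
      (fun h N hN hinf hacc => ?_)
    · simp only [Finset.mem_powerset]
      intro a ha
      simpa [Nat.lt_succ_iff] using F.le_max' a ha
    · exact h L (fun x hx => ⟨hL hx, hlt _ hmax x hx⟩) hinf hlt
    · exact h (N ∩ Set.Ioi (F.max' hne)) (Set.inter_subset_inter_left _ hN)
        (infinite_inter_Ioi hinf _) (hacc.mono Set.inter_subset_left)

/-- If there were infinitely many such `m`, the set of them would accept `F`: for `L` inside it with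
least element `m`, acceptance of `insert m F` applied to the rest of `L` yields an initial segment
of `L`. -/
theorem NashWilliamsRejects.finite_accepts {𝓕 : Set (Finset ℕ)} {D : Set ℕ} {F : Finset ℕ}
    (h : NashWilliamsRejects 𝓕 D F) :
    {m ∈ D | (∀ a ∈ F, a < m) ∧ NashWilliamsAccepts 𝓕 D (insert m F)}.Finite := by
  classical
  by_contra hinf
  refine h _ (fun m hm => hm.1) hinf ?_
  intro L hL hLinf hlt
  have hm := Nat.sInf_mem hLinf.nonempty
  set m := sInf L
  obtain ⟨n, hn⟩ := (hL hm).2.2 (L ∩ Set.Ioi m) (fun x hx => (hL hx.1).1)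
    (infinite_inter_Ioi hLinf m) (by
      intro a ha b hb
      rcases Finset.mem_insert.1 ha with rfl | ha
      · exact hb.2
      · exact hlt a ha b hb.1)
  -- The bound `m + 1` keeps `m` in the initial segment even when `n` is small.
  refine ⟨max n (m + 1), ?_⟩
  convert hn using 1
  ext x
  have hle : x ∈ L → m ≤ x := fun hx => Nat.sInf_le hx
  simp only [Finset.mem_union, Finset.mem_filter, Finset.mem_range, Finset.mem_insert,
    Set.mem_inter_iff, Set.mem_Ioi]
  by_cases hx : x ∈ F
  · simp [hx]
  · by_cases hxL : x ∈ L
    · have := hle hxL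
      simp only [hx, hxL, false_or, or_false, true_and, and_true]
      omega
    · have : x ≠ m := fun h => hxL (h ▸ hm)
      simp [hx, hxL, this]

open Classical in
/-- Galvin's form of the Nash-Williams partition theorem. -/
theorem exists_infinite_forall_notMem_or_forall_initial_mem (𝓕 : Set (Finset ℕ)) :
    ∃ M : Set ℕ, M.Infinite ∧ ((∀ F : Finset ℕ, (F : Set ℕ) ⊆ M → F ∉ 𝓕) ∨
      ∀ L ⊆ M, L.Infinite → ∃ n, (Finset.range n).filter (· ∈ L) ∈ 𝓕) := by
  obtain ⟨D, hD, hdec⟩ := exists_infinite_decides_all 𝓕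
  rcases hdec ∅ (by simp) with hacc | hrej
  · refine ⟨D, hD, Or.inr fun L hL hinf => ?_⟩
    simpa using hacc L hL hinf (by simp)
  set A : Finset ℕ → Set ℕ :=
    fun F => {m ∈ D | (∀ a ∈ F, a < m) ∧ NashWilliamsAccepts 𝓕 D (insert m F)} with hA
  have key : ∀ F : Finset ℕ, (F : Set ℕ) ⊆ D → ∀ m ∈ D, (∀ a ∈ F, a < m) → m ∉ A F →
      NashWilliamsRejects 𝓕 D (insert m F) := by
    intro F hF m hm hlt hmA
    refine (hdec (insert m F) ?_).resolve_left fun h => hmA ⟨hm, hlt, h⟩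
    simpa [Set.insert_subset_iff] using ⟨hm, hF⟩
  -- `D'` avoids the finite exceptional sets `A F` of earlier rejected `F`, so by `key` rejection
  -- propagates from `∅` to every finite subset of `D'`.
  obtain ⟨D', hD'D, hD', hQ⟩ := exists_infinite_fusion
    (Q := fun n N => ∀ F ∈ (Finset.range (n + 1)).powerset, (F : Set ℕ) ⊆ D →
      NashWilliamsRejects 𝓕 D F → ∀ m ∈ N, m ∉ A F)
    (fun n N N' hN h F hF h1 h2 m hm => h F hF h1 h2 m (hN hm))
    (hD.sdiff hrej.finite_accepts) (fun n L _ hL => by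
      refine ⟨L \ ⋃ F ∈ {F ∈ (Finset.range (n + 1)).powerset | NashWilliamsRejects 𝓕 D F}, A F,
        Set.sdiff_subset, hL.sdiff ?_, ?_⟩
      · refine Set.Finite.biUnion (Finset.finite_toSet _) fun F hF => ?_
        exact (Finset.mem_filter.1 (Finset.mem_coe.1 hF)).2.finite_accepts
      · intro F hF _ hr m hm hmA
        refine hm.2 (Set.mem_biUnion (x := F) ?_ hmA)
        exact Finset.mem_coe.2 (Finset.mem_filter.2 ⟨hF, hr⟩))
  refine ⟨D', hD', Or.inl fun F hF => ?_⟩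
  have hrejall : ∀ F : Finset ℕ, (F : Set ℕ) ⊆ D' → NashWilliamsRejects 𝓕 D F := by
    intro F
    induction F using Finset.induction_on_max with
    | empty => exact fun _ => hrej
    | insert m F hlt ih =>
      intro hF
      rw [Finset.coe_insert, Set.insert_subset_iff] at hF
      have hFD : (F : Set ℕ) ⊆ D := fun x hx => (hD'D (hF.2 hx)).1
      refine key F hFD m (hD'D hF.1).1 hlt ?_
      rcases F.eq_empty_or_nonempty with rfl | hne
      · exact (hD'D hF.1).2
      · refine hQ (F.max' hne) (hF.2 (F.max'_mem hne)) F ?_ hFD (ih hF.2) m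
          ⟨hF.1, hlt _ (F.max'_mem hne)⟩
        simp only [Finset.mem_powerset]
        intro a ha
        simpa [Nat.lt_succ_iff] using F.le_max' a ha
  intro hmem
  -- A member of `𝓕` is accepted at once, with the empty initial segment.
  exact hrejall F hF D subset_rfl hD fun L _ _ _ => ⟨0, by simpa using hmem⟩

/-! ### Rosenthal's dichotomy and lower `ℓ¹`-estimates. -/

/-- Diagonalisation over countably many hereditary properties of infinite sets. -/
theorem exists_infinite_forall_tail {P : ℕ → Set ℕ → Prop}
    (mono : ∀ i N N', N' ⊆ N → P i N → P i N')
    (h : ∀ i, ∀ L : Set ℕ, L.Infinite → ∃ N ⊆ L, N.Infinite ∧ P i N) :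
    ∃ D : Set ℕ, D.Infinite ∧ ∀ i, ∃ n, P i (D ∩ Set.Ioi n) := by
  obtain ⟨D, -, hD, hQ⟩ := exists_infinite_fusion (Q := fun n N => ∀ i ≤ n, P i N)
    (fun n N N' hN h i hi => mono i N N' hN (h i hi)) Set.infinite_univ (fun n L _ hL => by
      induction n with
      | zero =>
        obtain ⟨N, hNL, hN, hP⟩ := h 0 L hL
        exact ⟨N, hNL, hN, fun i hi => by rwa [Nat.le_zero.1 hi]⟩
      | succ n ih =>
        obtain ⟨N, hNL, hN, hP⟩ := ih
        obtain ⟨N', hN', hinf, hP'⟩ := h (n + 1) N hN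
        refine ⟨N', hN'.trans hNL, hinf, fun i hi => ?_⟩
        rcases hi.lt_or_eq with hi | rfl
        · exact mono i N N' hN' (hP i (Nat.lt_succ_iff.1 hi))
        · exact hP')
  refine ⟨D, hD, fun i => ?_⟩
  obtain ⟨n, hn, hin⟩ := hD.exists_gt i
  exact ⟨n, hQ n hn i hin.le⟩

/-- Diagonalising over all rational pairs `r < s` removes every rational upcrossing, and a bounded
real sequence without these converges. -/
theorem exists_pointwise_tendsto_of_forall_exists_no_oscillation {S : Type*} {f : ℕ → S → ℝ}
    {C : ℝ} (hb : ∀ n x, |f n x| ≤ C)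
    (h : ∀ r s : ℝ, r < s → ∀ M : Set ℕ, M.Infinite → ∃ L ⊆ M, L.Infinite ∧
      ∀ x, ¬ ({n ∈ L | f n x < r}.Infinite ∧ {n ∈ L | s < f n x}.Infinite)) :
    ∃ φ : ℕ → ℕ, StrictMono φ ∧ ∀ x, ∃ c, Tendsto (fun n => f (φ n) x) atTop (𝓝 c) := by
  obtain ⟨e, he⟩ := exists_surjective_nat (ℚ × ℚ)
  obtain ⟨D, hD, hP⟩ := exists_infinite_forall_tail
    (P := fun i N => ((e i).1 : ℝ) < (e i).2 → ∀ x,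
      ¬ ({n ∈ N | f n x < (e i).1}.Infinite ∧ {n ∈ N | ((e i).2 : ℝ) < f n x}.Infinite))
    (fun i N N' hN h hlt x hx => h hlt x
      ⟨hx.1.mono fun n hn => ⟨hN hn.1, hn.2⟩, hx.2.mono fun n hn => ⟨hN hn.1, hn.2⟩⟩)
    (fun i L hL => by
      by_cases hlt : ((e i).1 : ℝ) < (e i).2
      · obtain ⟨N, hN, hinf, hx⟩ := h _ _ hlt L hL
        exact ⟨N, hN, hinf, fun _ => hx⟩
      · exact ⟨L, subset_rfl, hL, fun h => absurd h hlt⟩)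
  have hmono := Nat.nth_strictMono (p := (· ∈ D)) hD
  have hmem := Nat.nth_mem_of_infinite (p := (· ∈ D)) hD
  refine ⟨Nat.nth (· ∈ D), hmono, fun x => ?_⟩
  refine tendsto_of_no_upcrossings (s := Set.range ((↑) : ℚ → ℝ)) Rat.denseRange_cast ?_
    (isBoundedUnder_of ⟨C, fun n => (abs_le.1 (hb _ x)).2⟩)
    (isBoundedUnder_of ⟨-C, fun n => (abs_le.1 (hb _ x)).1⟩)
  rintro _ ⟨a, rfl⟩ _ ⟨b, rfl⟩ hab ⟨h1, h2⟩
  obtain ⟨i, hi⟩ := he (a, b)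
  obtain ⟨m, hm⟩ := hP i
  have key : ∀ q : ℕ → Prop, (∃ᶠ n in atTop, q (Nat.nth (· ∈ D) n)) →
      {n ∈ D ∩ Set.Ioi m | q n}.Infinite := by
    intro q hq
    have := (Nat.frequently_atTop_iff_infinite.1
      (hq.and_eventually (hmono.tendsto_atTop.eventually_gt_atTop m))).image hmono.injective.injOn
    refine this.mono ?_
    rintro _ ⟨n, ⟨h1, h2⟩, rfl⟩
    exact ⟨⟨hmem n, h2⟩, h1⟩
  rw [hi] at hm
  exact hm hab x ⟨key _ h1, key _ h2⟩

/-- The values `f j x`, `j ∈ F`, are alternately above `s` and below `r`. -/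
def AlternatesOn {S : Type*} (f : ℕ → S → ℝ) (r s : ℝ) (F : Finset ℕ) (x : S) : Prop :=
  ∀ j ∈ F, (Even (F.filter (· < j)).card → s < f j x) ∧
    (¬ Even (F.filter (· < j)).card → f j x < r)

-- Galvin's theorem is applied to the finite sets with no alternating point. Its second alternative
-- is impossible: an oscillation point on `M` alternates along a suitable infinite subset of `M`,
-- hence on each initial segment of that subset.
open Classical in
theorem exists_infinite_forall_alternatesOn {S : Type*} {f : ℕ → S → ℝ} {r s : ℝ}
    (h : ∀ L : Set ℕ, L.Infinite →
      ∃ x, {n ∈ L | f n x < r}.Infinite ∧ {n ∈ L | s < f n x}.Infinite) :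
    ∃ M : Set ℕ, M.Infinite ∧ ∀ F : Finset ℕ, (F : Set ℕ) ⊆ M → ∃ x, AlternatesOn f r s F x := by
  obtain ⟨M, hM, hM'⟩ := exists_infinite_forall_notMem_or_forall_initial_mem
    {F | ¬ ∃ x, AlternatesOn f r s F x}
  rcases hM' with hM' | hM'
  · exact ⟨M, hM, fun F hF => not_not.1 (hM' F hF)⟩
  exfalso
  obtain ⟨x, h1, h2⟩ := h M hM
  obtain ⟨φ, hφ, hφP⟩ := extraction_forall_of_frequently
    (P := fun k n => n ∈ M ∧ (Even k → s < f n x) ∧ (¬ Even k → f n x < r)) (by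
      intro k
      rw [Nat.frequently_atTop_iff_infinite]
      by_cases hk : Even k
      · simpa [hk] using h2
      · simpa [hk] using h1)
  obtain ⟨n, hn⟩ := hM' (Set.range φ) (by rintro _ ⟨k, rfl⟩; exact (hφP k).1)
    (Set.infinite_range_of_injective hφ.injective)
  refine hn ⟨x, ?_⟩
  intro j hj
  obtain ⟨hjn, k, rfl⟩ := Finset.mem_filter.1 hj
  have : (((Finset.range n).filter (· ∈ Set.range φ)).filter (· < φ k)) =
      (Finset.range k).image φ := by
    ext i
    simp only [Finset.mem_filter, Finset.mem_range, Set.mem_range, Finset.mem_image] at hjn ⊢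
    constructor
    · rintro ⟨⟨-, l, rfl⟩, hl⟩
      exact ⟨l, hφ.lt_iff_lt.1 hl, rfl⟩
    · rintro ⟨l, hl, rfl⟩
      have := hφ hl
      exact ⟨⟨by omega, l, rfl⟩, this⟩
  rw [this, Finset.card_image_of_injective _ hφ.injective, Finset.card_range]
  exact (hφP k).2

/-- The odd-indexed `m (2 * i + 1)` always belong to `F`; the spare element `m (2 * i)` is inserted
exactly when the parity needs correcting. Alternation on `F` thereby becomes an arbitrary sign
pattern on the odd indices. -/
theorem exists_finset_parity {M : Set ℕ} {m : ℕ → ℕ} (hm : StrictMono m) (hmM : ∀ n, m n ∈ M)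
    (σ : ℕ → Prop) (n : ℕ) : ∃ F : Finset ℕ, (F : Set ℕ) ⊆ M ∧ (∀ a ∈ F, a < m (2 * n)) ∧
      ∀ i < n, m (2 * i + 1) ∈ F ∧ (σ i ↔ Even (F.filter (· < m (2 * i + 1))).card) := by
  classical
  induction n with
  | zero => exact ⟨∅, by simp⟩
  | succ n ih =>
    obtain ⟨F, hFM, hlt, hF⟩ := ih
    have h01 : m (2 * n) < m (2 * n + 1) := hm (by omega)
    have h12 : m (2 * n + 1) < m (2 * (n + 1)) := hm (by omega)
    have main : ∀ G : Finset ℕ, (G : Set ℕ) ⊆ M → (∀ a ∈ G, a < m (2 * n + 1)) → F ⊆ G →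
        (∀ a ∈ G, a ∉ F → m (2 * n) ≤ a) → (σ n ↔ Even G.card) →
        ∃ F : Finset ℕ, (F : Set ℕ) ⊆ M ∧ (∀ a ∈ F, a < m (2 * (n + 1))) ∧
      ∀ i < n + 1, m (2 * i + 1) ∈ F ∧ (σ i ↔ Even (F.filter (· < m (2 * i + 1))).card) := by
      intro G hGM hGlt hFG hGF hσ
      refine ⟨insert (m (2 * n + 1)) G, ?_, ?_, ?_⟩
      · simpa [Set.insert_subset_iff] using ⟨hmM _, hGM⟩
      · intro a ha
        rcases Finset.mem_insert.1 ha with rfl | ha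
        · exact h12
        · exact (hGlt a ha).trans h12
      · intro i hi
        rcases (Nat.lt_succ_iff.1 hi).lt_or_eq with hi | rfl
        · refine ⟨Finset.mem_insert_of_mem (hFG (hF i hi).1), ?_⟩
          rw [(hF i hi).2]
          have hii : m (2 * i + 1) < m (2 * n) := hm (by omega)
          have : (insert (m (2 * n + 1)) G).filter (· < m (2 * i + 1)) =
              F.filter (· < m (2 * i + 1)) := by
            ext a
            simp only [Finset.mem_filter, Finset.mem_insert]
            constructor
            · rintro ⟨rfl | ha, hai⟩
              · omega
              · refine ⟨?_, hai⟩
                by_contra haF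
                have := hGF a ha haF
                omega
            · rintro ⟨ha, hai⟩
              exact ⟨Or.inr (hFG ha), hai⟩
          rw [this]
        · refine ⟨Finset.mem_insert_self _ _, ?_⟩
          rw [hσ]
          have : (insert (m (2 * i + 1)) G).filter (· < m (2 * i + 1)) = G := by
            ext a
            simp only [Finset.mem_filter, Finset.mem_insert]
            constructor
            · rintro ⟨rfl | ha, hai⟩
              · omega
              · exact ha
            · exact fun ha => ⟨Or.inr ha, hGlt a ha⟩
          rw [this]
    by_cases hσ : σ n ↔ Even F.card
    · exact main F hFM (fun a ha => (hlt a ha).trans h01) subset_rfl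
        (fun a ha h => absurd ha h) hσ
    · have hnot : m (2 * n) ∉ F := fun h => (hlt _ h).false
      refine main (insert (m (2 * n)) F) ?_ ?_ (Finset.subset_insert _ _) ?_ ?_
      · simpa [Set.insert_subset_iff] using ⟨hmM _, hFM⟩
      · intro a ha
        rcases Finset.mem_insert.1 ha with rfl | ha
        · exact h01
        · exact (hlt a ha).trans h01
      · intro a ha haF
        rcases Finset.mem_insert.1 ha with rfl | ha
        · exact le_rfl
        · exact absurd ha haF
      · rw [Finset.card_insert_of_notMem hnot, Nat.even_add_one]
        tauto

/-- Rosenthal's dichotomy: a uniformly bounded sequence of functions has a pointwise convergent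
subsequence or a Boolean independent subsequence. -/
theorem exists_pointwise_tendsto_or_independent {S : Type*} {f : ℕ → S → ℝ}
    {C : ℝ} (hb : ∀ n x, |f n x| ≤ C) :
    (∃ φ : ℕ → ℕ, StrictMono φ ∧ ∀ x, ∃ c, Tendsto (fun n => f (φ n) x) atTop (𝓝 c)) ∨
    ∃ (φ : ℕ → ℕ) (r s : ℝ), r < s ∧ ∀ (σ : ℕ → Prop) (n : ℕ), ∃ x, ∀ i < n,
      (σ i → s < f (φ i) x) ∧ (¬ σ i → f (φ i) x < r) := by
  by_cases H : ∀ r s : ℝ, r < s → ∀ M : Set ℕ, M.Infinite → ∃ L ⊆ M, L.Infinite ∧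
      ∀ x, ¬ ({n ∈ L | f n x < r}.Infinite ∧ {n ∈ L | s < f n x}.Infinite)
  · exact Or.inl (exists_pointwise_tendsto_of_forall_exists_no_oscillation hb H)
  right
  push Not at H
  obtain ⟨r, s, hrs, M, hM, hosc⟩ := H
  have hψ := Nat.nth_strictMono (p := (· ∈ M)) hM
  have hψM := Nat.nth_mem_of_infinite (p := (· ∈ M)) hM
  set ψ := Nat.nth (· ∈ M)
  obtain ⟨N, hN, halt⟩ := exists_infinite_forall_alternatesOn (f := fun n => f (ψ n))
    (r := r) (s := s) (fun L hL => by
      obtain ⟨x, h1, h2⟩ := hosc (ψ '' L) (by rintro _ ⟨k, -, rfl⟩; exact hψM k)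
        (hL.image hψ.injective.injOn)
      refine ⟨x, ?_, ?_⟩
      · refine Set.Infinite.of_image ψ (h1.mono ?_)
        rintro _ ⟨⟨k, hk, rfl⟩, h⟩
        exact ⟨k, ⟨hk, h⟩, rfl⟩
      · refine Set.Infinite.of_image ψ (h2.mono ?_)
        rintro _ ⟨⟨k, hk, rfl⟩, h⟩
        exact ⟨k, ⟨hk, h⟩, rfl⟩)
  have hm := Nat.nth_strictMono (p := (· ∈ N)) hN
  have hmN := Nat.nth_mem_of_infinite (p := (· ∈ N)) hN
  set m := Nat.nth (· ∈ N)
  refine ⟨fun i => ψ (m (2 * i + 1)), r, s, hrs, fun σ n => ?_⟩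
  obtain ⟨F, hFN, -, hF⟩ := exists_finset_parity hm hmN σ n
  obtain ⟨x, hx⟩ := halt F hFN
  refine ⟨x, fun i hi => ?_⟩
  have := hx _ (hF i hi).1
  rwa [← (hF i hi).2] at this

/-- A bounded sequence in the dual has a pointwise convergent subsequence or a subsequence
satisfying a lower `ℓ¹`-estimate. -/
theorem exists_pointwise_tendsto_or_lower_l1 {Y : Type*} [NormedAddCommGroup Y]
    [NormedSpace ℝ Y] {f : ℕ → StrongDual ℝ Y} {C : ℝ} (hC : ∀ n, ‖f n‖ ≤ C) :
    (∃ φ : ℕ → ℕ, StrictMono φ ∧ ∀ x, ∃ c, Tendsto (fun n => f (φ n) x) atTop (𝓝 c)) ∨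
    ∃ (φ : ℕ → ℕ) (c : ℝ), 0 < c ∧ ∀ a : ℕ →₀ ℝ,
      c * (a.sum fun _ t => |t|) ≤ ‖Finsupp.linearCombination ℝ (fun n => f (φ n)) a‖ := by
  have hC0 : 0 ≤ C := (norm_nonneg _).trans (hC 0)
  rcases exists_pointwise_tendsto_or_independent
    (f := fun n (x : Metric.closedBall (0 : Y) 1) => f n x) (C := C) (fun n x => by
      have hx : ‖(x : Y)‖ ≤ 1 := mem_closedBall_zero_iff.1 x.2
      calc |f n x| ≤ ‖f n‖ * ‖(x : Y)‖ := (f n).le_opNorm _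
        _ ≤ C * 1 := by gcongr; exact hC n
        _ = C := mul_one C) with ⟨φ, hφ, h⟩ | ⟨φ, r, s, hrs, h⟩
  · refine Or.inl ⟨φ, hφ, fun x => ?_⟩
    have hpos : 0 < ‖x‖ + 1 := by positivity
    obtain ⟨c, hc⟩ := h ⟨(‖x‖ + 1)⁻¹ • x, by
      rw [mem_closedBall_zero_iff, norm_smul, norm_inv, Real.norm_of_nonneg hpos.le,
        inv_mul_le_iff₀ hpos]
      linarith⟩
    refine ⟨(‖x‖ + 1) * c, (hc.const_mul (‖x‖ + 1)).congr fun n => ?_⟩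
    simp only [map_smul, smul_eq_mul]
    field_simp
  -- Points `x`, `x'` realising the sign pattern of `a` and its opposite give `T x - T x' ≥ (s - r)
  -- ∑ |a i|`, while the left side is at most `2 ‖T‖`.
  · refine Or.inr ⟨φ, (s - r) / 2, by linarith, fun a => ?_⟩
    obtain ⟨n, hn⟩ : ∃ n, ∀ i ∈ a.support, i < n :=
      ⟨a.support.sup id + 1, fun i hi => Nat.lt_succ_iff.2 (Finset.le_sup (f := id) hi)⟩
    obtain ⟨x, hx⟩ := h (fun i => 0 ≤ a i) n
    obtain ⟨x', hx'⟩ := h (fun i => ¬ 0 ≤ a i) n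
    set T := Finsupp.linearCombination ℝ (fun n => f (φ n)) a with hT
    have happ : ∀ z : Y, T z = ∑ i ∈ a.support, a i * f (φ i) z := by
      intro z
      simp [hT, Finsupp.linearCombination_apply, Finsupp.sum]
    have hle : ∀ z : Metric.closedBall (0 : Y) 1, |T z| ≤ ‖T‖ := fun z =>
      (T.le_opNorm _).trans (mul_le_of_le_one_right (norm_nonneg _) (mem_closedBall_zero_iff.1 z.2))
    have h1 : (s - r) * ∑ i ∈ a.support, |a i| ≤ T x - T x' := by
      rw [happ, happ, ← Finset.sum_sub_distrib, Finset.mul_sum]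
      refine Finset.sum_le_sum fun i hi => ?_
      have e1 := hx i (hn i hi)
      have e2 := hx' i (hn i hi)
      by_cases hi0 : 0 ≤ a i
      · have e1 := e1.1 hi0
        have e2 := e2.2 (not_not.2 hi0)
        rw [abs_of_nonneg hi0]
        nlinarith
      · have e1 := e1.2 hi0
        have e2 := e2.1 hi0
        rw [abs_of_neg (not_le.1 hi0)]
        nlinarith [not_le.1 hi0]
    have h2 := abs_le.1 (hle x)
    have h3 := abs_le.1 (hle x')
    simp only [Finsupp.sum]
    linarith

/-! ### The Hagler–Johnson construction: stable tail combinations. -/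

/-- `v` is a sequence of absolutely convex combinations of tails of `u`. -/
def IsTailCombination {V : Type*} [AddCommGroup V] [Module ℝ V] (v u : ℕ → V) : Prop :=
  ∀ N, ∀ᶠ n in atTop, v n ∈ absConvexHull ℝ (u '' Set.Ici N)

theorem IsTailCombination.refl {V : Type*} [AddCommGroup V] [Module ℝ V] (u : ℕ → V) :
    IsTailCombination u u := fun N => by
  filter_upwards [eventually_ge_atTop N] with n hn
  exact subset_absConvexHull ⟨n, hn, rfl⟩

theorem IsTailCombination.trans {V : Type*} [AddCommGroup V] [Module ℝ V] {w v u : ℕ → V}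
    (h : IsTailCombination w v) (h' : IsTailCombination v u) : IsTailCombination w u := fun N => by
  obtain ⟨N', hN'⟩ := eventually_atTop.1 (h' N)
  filter_upwards [h N'] with n hn
  refine absConvexHull_min ?_ absConvex_absConvexHull hn
  rintro _ ⟨i, hi, rfl⟩
  exact hN' i hi

theorem IsTailCombination.comp_strictMono {V : Type*} [AddCommGroup V] [Module ℝ V] (u : ℕ → V)
    {φ : ℕ → ℕ} (hφ : StrictMono φ) : IsTailCombination (u ∘ φ) u := fun N => by
  filter_upwards [eventually_ge_atTop N] with n hn
  exact subset_absConvexHull ⟨φ n, hn.trans (hφ.le_apply), rfl⟩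

theorem exists_diagonal_tailCombination {V : Type*} [AddCommGroup V] [Module ℝ V]
    {A : Set V} {s : ℕ → ℕ → V} (hA : ∀ k n, s k n ∈ A)
    (h : ∀ k, IsTailCombination (s (k + 1)) (s k)) :
    ∃ z : ℕ → V, (∀ n, z n ∈ A) ∧ ∀ k, IsTailCombination z (s k) := by
  have hle : ∀ k j, k ≤ j → IsTailCombination (s j) (s k) := by
    intro k j hkj
    induction j, hkj using Nat.le_induction with
    | base => exact .refl _
    | succ j _ ih => exact (h j).trans ih
  -- A late enough term of the `n`-th sequence is a combination of far terms of all previous ones at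
  -- once.
  have : ∀ n, ∃ m, ∀ j ≤ n, s n m ∈ absConvexHull ℝ (s j '' Set.Ici n) := by
    intro n
    have : ∀ᶠ m in atTop, ∀ j ∈ Finset.range (n + 1),
        s n m ∈ absConvexHull ℝ (s j '' Set.Ici n) :=
      (Finset.eventually_all _).2 fun j hj =>
        hle j n (Nat.lt_succ_iff.1 (Finset.mem_range.1 hj)) n
    obtain ⟨m, hm⟩ := this.exists
    exact ⟨m, fun j hj => hm j (Finset.mem_range.2 (Nat.lt_succ_iff.2 hj))⟩
  choose m hm using this
  refine ⟨fun n => s n (m n), fun n => hA _ _, fun k N => ?_⟩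
  filter_upwards [eventually_ge_atTop (max k N)] with n hn
  exact absConvexHull_mono
    (Set.image_mono (Set.Ici_subset_Ici.2 ((le_max_right _ _).trans hn)))
    (hm n k ((le_max_left _ _).trans hn))

/-- A nonnegative monotone function on a preorder whose decreasing sequences have lower bounds is
constant below some element. -/
theorem exists_stable_of_forall_exists_lowerBound {α : Type*} {r : α → α → Prop}
    (refl : ∀ a, r a a) (trans : ∀ a b c, r a b → r b c → r a c)
    (lower : ∀ s : ℕ → α, (∀ k, r (s (k + 1)) (s k)) → ∃ z, ∀ k, r z (s k))
    {δ : α → ℝ} (mono : ∀ v u, r v u → δ v ≤ δ u) (nonneg : ∀ u, 0 ≤ δ u) (u : α) :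
    ∃ z, r z u ∧ ∀ v, r v z → δ v = δ z := by
  -- Choosing a `1/(k+1)`-minimiser of `δ` at each step, a lower bound of the resulting chain has
  -- nothing smaller below it.
  have hstep : ∀ (k : ℕ) (u : α), ∃ v, r v u ∧ ∀ w, r w u → δ v ≤ δ w + 1 / ((k : ℝ) + 1) := by
    intro k u
    have hbdd : BddBelow (δ '' {v | r v u}) := ⟨0, by rintro _ ⟨v, -, rfl⟩; exact nonneg v⟩
    have hpos : (0 : ℝ) < 1 / ((k : ℝ) + 1) := by positivity
    obtain ⟨_, ⟨v, hv, rfl⟩, hlt⟩ := exists_lt_of_csInf_lt (s := δ '' {v | r v u})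
      ⟨_, u, refl u, rfl⟩ (lt_add_of_pos_right (sInf (δ '' {v | r v u})) hpos)
    refine ⟨v, hv, fun w hw => hlt.le.trans ?_⟩
    gcongr
    exact csInf_le hbdd ⟨w, hw, rfl⟩
  choose f hf hf' using hstep
  let s : ℕ → α := fun k => Nat.rec u (fun k v => f k v) k
  obtain ⟨z, hz⟩ := lower s fun k => hf k (s k)
  refine ⟨z, hz 0, fun v hv => le_antisymm (mono _ _ hv) ?_⟩
  refine le_of_forall_pos_le_add fun ε hε => ?_
  obtain ⟨k, hk⟩ := exists_nat_one_div_lt hε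
  calc δ z ≤ δ (s (k + 1)) := mono _ _ (hz (k + 1))
    _ ≤ δ v + 1 / ((k : ℝ) + 1) := hf' k (s k) v (trans _ _ _ hv (hz k))
    _ ≤ δ v + ε := by gcongr

/-- The `ℓ¹`-norm of a finitely supported sequence. -/
def finsuppL1 (a : ℕ →₀ ℝ) : ℝ := a.sum fun _ t => |t|

theorem finsuppL1_add {a b : ℕ →₀ ℝ} (h : Disjoint a.support b.support) :
    finsuppL1 (a + b) = finsuppL1 a + finsuppL1 b :=
  Finsupp.sum_add_index_of_disjoint h _

theorem finsuppL1_smul (t : ℝ) (a : ℕ →₀ ℝ) : finsuppL1 (t • a) = |t| * finsuppL1 a := by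
  rcases eq_or_ne t 0 with rfl | ht
  · simp [finsuppL1]
  · simp [finsuppL1, Finsupp.sum, Finsupp.support_smul_eq ht, abs_mul, Finset.mul_sum]

theorem finsuppL1_sum {ι : Type*} (J : Finset ι) (a : ι → ℕ →₀ ℝ)
    (h : (J : Set ι).Pairwise fun i j => Disjoint (a i).support (a j).support) :
    finsuppL1 (∑ j ∈ J, a j) = ∑ j ∈ J, finsuppL1 (a j) := by
  classical
  induction J using Finset.induction_on with
  | empty => simp [finsuppL1]
  | insert i J hi ih =>
    rw [Finset.sum_insert hi, Finset.sum_insert hi, finsuppL1_add, ih]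
    · exact h.mono (by simp)
    · refine Disjoint.mono_right Finsupp.support_finsetSum ?_
      rw [Finset.disjoint_biUnion_right]
      intro j hj
      exact h (by simp) (by simp [hj]) (by rintro rfl; exact hi hj)

/-- A combination of basis vectors beyond `N` vanishes on the first `N` coordinates, so each chosen
support lies eventually outside the later ones. -/
theorem IsTailCombination.exists_disjoint_subsequence {u : ℕ → ℕ →₀ ℝ}
    (h : IsTailCombination u fun n => Finsupp.single n 1) :
    ∃ φ : ℕ → ℕ, StrictMono φ ∧
      Pairwise fun i j => Disjoint (u (φ i)).support (u (φ j)).support := by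
  have hsupp : ∀ N, ∀ᶠ n in atTop, ∀ i < N, u n i = 0 := by
    intro N
    filter_upwards [h N] with n hn
    have : absConvexHull ℝ ((fun n => Finsupp.single n (1 : ℝ)) '' Set.Ici N) ⊆
        {a : ℕ →₀ ℝ | ∀ i < N, a i = 0} := by
      refine absConvexHull_min ?_ ⟨?_, ?_⟩
      · rintro _ ⟨k, hk, rfl⟩ i hi
        exact Finsupp.single_eq_of_ne (by have : N ≤ k := hk; omega)
      · rw [balanced_iff_smul_mem]
        intro t _ a ha i hi
        simp [ha i hi]
      · intro a ha b hb s t _ _ _ i hi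
        simp [ha i hi, hb i hi]
    exact this hn
  have hg : ∀ n, ∃ m, n < m ∧ ∀ k ≥ m, Disjoint (u n).support (u k).support := by
    intro n
    obtain ⟨N, hN⟩ : ∃ N, ∀ i ∈ (u n).support, i < N :=
      ⟨(u n).support.sup id + 1, fun i hi => Nat.lt_succ_iff.2 (Finset.le_sup (f := id) hi)⟩
    obtain ⟨m, hm⟩ := eventually_atTop.1 (hsupp N)
    refine ⟨max m (n + 1), by omega, fun k hk => ?_⟩
    rw [Finset.disjoint_left]
    intro i hi hik
    exact (Finsupp.mem_support_iff.1 hik) (hm k (le_of_max_le_left hk) i (hN i hi))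
  choose g hlt hdisj using hg
  have hφ : StrictMono fun k => g^[k] 0 := strictMono_nat_of_lt_succ fun k => by
    simp only [Function.iterate_succ_apply']
    exact hlt _
  refine ⟨fun k => g^[k] 0, hφ, ?_⟩
  have key : ∀ i j, i < j → Disjoint (u (g^[i] 0)).support (u (g^[j] 0)).support := by
    intro i j hij
    refine hdisj _ _ ?_
    rw [← Function.iterate_succ_apply' g]
    exact hφ.monotone hij
  intro i j hij
  rcases lt_or_gt_of_ne hij with h | h
  · exact key i j h
  · exact (key j i h).symm

/-- Finitely many infinite sets of naturals have distinct representatives beyond any `n`. -/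
theorem exists_injective_mem_of_infinite {J : Type*} [Fintype J] {N : J → Set ℕ}
    (hN : ∀ j, (N j).Infinite) (n : ℕ) :
    ∃ a : J → ℕ, Function.Injective a ∧ ∀ j, a j ∈ N j ∧ n < a j := by
  classical
  have : ∀ j, ∃ t : Finset ℕ, (t : Set ℕ) ⊆ N j ∩ Set.Ioi n ∧ t.card = Fintype.card J :=
    fun j => (infinite_inter_Ioi (hN j) n).exists_subset_card_eq _
  choose t ht hcard using this
  -- Hall's condition is trivial, as every `t j` is as large as `J`.
  obtain ⟨a, ha, hat⟩ := (Finset.all_card_le_biUnion_card_iff_exists_injective t).1 (by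
    intro s
    rcases s.eq_empty_or_nonempty with rfl | ⟨j, hj⟩
    · simp
    · calc s.card ≤ Fintype.card J := s.card_le_univ
        _ = (t j).card := (hcard j).symm
        _ ≤ (s.biUnion t).card := Finset.card_le_card (Finset.subset_biUnion_of_mem t hj))
  exact ⟨a, ha, fun j => ht j (hat j)⟩

/-- Stage `k` carries the finite family of all cells cut out by the first `k` points; the next point
is chosen to split every cell at once. -/
theorem exists_dyadic_tree {X : Type*} {S : X → Bool → Set ℕ}
    (h : ∀ 𝒩 : Set (Set ℕ), 𝒩.Finite → (∀ N ∈ 𝒩, N.Infinite) →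
      ∃ x, ∀ N ∈ 𝒩, ∀ b, (N ∩ S x b).Infinite) :
    ∃ x : ℕ → X, ∀ (σ : ℕ → Bool) (n : ℕ), {m | ∀ i < n, m ∈ S (x i) (σ i)}.Infinite := by
  have : Nonempty X := ⟨(h ∅ Set.finite_empty (by simp)).choose⟩
  choose! x hx using h
  let s : ℕ → Set (Set ℕ) := fun k =>
    Nat.rec {Set.univ} (fun _ 𝒩 => Set.image2 (fun N b => N ∩ S (x 𝒩) b) 𝒩 Set.univ) k
  have hs : ∀ k, s (k + 1) = Set.image2 (fun N b => N ∩ S (x (s k)) b) (s k) Set.univ :=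
    fun _ => rfl
  have hfin : ∀ k, (s k).Finite ∧ ∀ N ∈ s k, N.Infinite := by
    intro k
    induction k with
    | zero =>
      refine ⟨Set.finite_singleton _, ?_⟩
      rintro N (rfl : N = Set.univ)
      exact Set.infinite_univ
    | succ k ih =>
      rw [hs]
      refine ⟨ih.1.image2 _ Set.finite_univ, ?_⟩
      rintro _ ⟨N, hN, b, -, rfl⟩
      exact hx _ ih.1 ih.2 N hN b
  refine ⟨fun k => x (s k), fun σ n => (hfin n).2 _ ?_⟩
  induction n with
  | zero => simp [s]
  | succ n ih =>
    rw [hs]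
    refine ⟨_, ih, σ n, Set.mem_univ _, ?_⟩
    ext m
    simp only [Set.mem_inter_iff, Set.mem_ofPred_eq]
    constructor
    · rintro ⟨h1, h2⟩ i hi
      rcases (Nat.lt_succ_iff.1 hi).lt_or_eq with hi | rfl
      · exact h1 i hi
      · exact h2
    · exact fun h => ⟨fun i hi => h i (by omega), h n (by omega)⟩

theorem isWeakStarNull_iff {X : Type*} [NormedAddCommGroup X] [NormedSpace ℝ X]
    {p : ℕ → StrongDual ℝ X} :
    IsWeakStarNull p ↔ ∀ x, Tendsto (fun n => p n x) atTop (𝓝 0) := by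
  rw [IsWeakStarNull, tendsto_iff_forall_eval_tendsto_topDualPairing]
  rfl

theorem IsWeakStarNull.isJNSequence {X : Type*} [NormedAddCommGroup X] [NormedSpace ℝ X]
    {p : ℕ → StrongDual ℝ X} (h : IsWeakStarNull p) {c : ℝ} (hc : 0 < c)
    (hp : ∀ n, c ≤ ‖p n‖) : IsJNSequence p :=
  ⟨h, hc.trans_le (le_ciInf hp)⟩

/-- `|T (uₙ) x|` is eventually at most any number larger than `d`, for `x` in the unit ball. -/
def LimsupBound {Y V : Type*} [NormedAddCommGroup Y] [NormedSpace ℝ Y] [AddCommGroup V]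
    [Module ℝ V] (T : V →ₗ[ℝ] StrongDual ℝ Y) (u : ℕ → V) (d : ℝ) : Prop :=
  ∀ x : Y, ‖x‖ ≤ 1 → ∀ ε > 0, ∀ᶠ n in atTop, |T (u n) x| ≤ d + ε

theorem LimsupBound.of_isTailCombination {Y V : Type*} [NormedAddCommGroup Y]
    [NormedSpace ℝ Y] [AddCommGroup V] [Module ℝ V] {T : V →ₗ[ℝ] StrongDual ℝ Y} {v u : ℕ → V}
    {d : ℝ} (h : LimsupBound T u d) (hv : IsTailCombination v u) : LimsupBound T v d := by
  intro x hx ε hε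
  obtain ⟨N, hN⟩ := eventually_atTop.1 (h x hx ε hε)
  filter_upwards [hv N] with n hn
  have : absConvexHull ℝ (u '' Set.Ici N) ⊆ {a | |T a x| ≤ d + ε} := by
    refine absConvexHull_min ?_ ⟨?_, ?_⟩
    · rintro _ ⟨i, hi, rfl⟩
      exact hN i hi
    · rw [balanced_iff_smul_mem]
      intro t ht a ha
      simp only [Set.mem_ofPred_eq, map_smul, smul_apply, smul_eq_mul,
        abs_mul] at ha ⊢
      exact (mul_le_of_le_one_left (abs_nonneg _) ht).trans ha
    · intro a ha b hb s t hs ht hst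
      simp only [Set.mem_ofPred_eq, map_smul, map_add, smul_apply,
        add_apply, smul_eq_mul] at ha hb ⊢
      calc |s * T a x + t * T b x| ≤ |s * T a x| + |t * T b x| := abs_add_le _ _
        _ = s * |T a x| + t * |T b x| := by
          rw [abs_mul, abs_mul, abs_of_nonneg hs, abs_of_nonneg ht]
        _ ≤ s * (d + ε) + t * (d + ε) := by gcongr
        _ = d + ε := by rw [← add_mul, hst, one_mul]
  exact this hn

/-- Among the sequences of `ℓ¹`-unit vectors subordinate to the unit vector basis there is one
on which `limsup` bounds cannot be improved by passing to further tail combinations. -/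
theorem exists_stable_limsupBound {Y : Type*} [NormedAddCommGroup Y] [NormedSpace ℝ Y]
    {T : (ℕ →₀ ℝ) →ₗ[ℝ] StrongDual ℝ Y} {C : ℝ} (hT : ∀ a, ‖T a‖ ≤ C * finsuppL1 a) :
    ∃ (z : ℕ → ℕ →₀ ℝ) (δ : ℝ), (∀ n, finsuppL1 (z n) = 1) ∧
      IsTailCombination z (fun n => Finsupp.single n 1) ∧ 0 ≤ δ ∧ LimsupBound T z δ ∧
      ∀ v, (∀ n, finsuppL1 (v n) = 1) → IsTailCombination v z → ∀ d, 0 ≤ d →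
        LimsupBound T v d → δ ≤ d := by
  let α := {u : ℕ → ℕ →₀ ℝ // ∀ n, finsuppL1 (u n) = 1}
  let D : α → Set ℝ := fun u => {d | 0 ≤ d ∧ LimsupBound T u.1 d}
  have hDne : ∀ u : α, (D u).Nonempty := by
    intro u
    have hle : ∀ n, ‖T (u.1 n)‖ ≤ C := fun n => by simpa [u.2 n] using hT (u.1 n)
    have hC : 0 ≤ C := (norm_nonneg _).trans (hle 0)
    refine ⟨C, hC, fun x hx ε hε => Eventually.of_forall fun n => ?_⟩
    calc |T (u.1 n) x| ≤ ‖T (u.1 n)‖ * ‖x‖ := (T (u.1 n)).le_opNorm x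
      _ ≤ C * 1 := mul_le_mul (hle n) hx (norm_nonneg _) hC
      _ ≤ C + ε := by linarith
  have hDbdd : ∀ u : α, BddBelow (D u) := fun u => ⟨0, fun d hd => hd.1⟩
  obtain ⟨z, hz, hz'⟩ := exists_stable_of_forall_exists_lowerBound
    (r := fun v u : α => IsTailCombination v.1 u.1) (fun _ => .refl _)
    (fun _ _ _ h h' => h.trans h') (fun s hs => by
      obtain ⟨z, hzA, hz⟩ := exists_diagonal_tailCombination
        (A := {a | finsuppL1 a = 1}) (fun k n => (s k).2 n) hs
      exact ⟨⟨z, hzA⟩, hz⟩)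
    (δ := fun u => sInf (D u))
    (fun v u h => csInf_le_csInf (hDbdd v) (hDne u)
      fun d hd => ⟨hd.1, hd.2.of_isTailCombination h⟩)
    (fun u => le_csInf (hDne u) fun d hd => hd.1)
    ⟨fun n => Finsupp.single n 1, fun n => by simp [finsuppL1]⟩
  refine ⟨z.1, sInf (D z), z.2, hz, le_csInf (hDne z) fun d hd => hd.1, ?_, ?_⟩
  · intro x hx ε hε
    obtain ⟨d, hd, hlt⟩ := exists_lt_of_csInf_lt (hDne z)
      (lt_add_of_pos_right (sInf (D z)) (half_pos hε))
    filter_upwards [hd.2 x hx (ε / 2) (half_pos hε)] with n hn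
    linarith
  · intro v hv hvz d hd hvd
    rw [← hz' ⟨v, hv⟩ hvz]
    exact csInf_le (hDbdd _) ⟨hd, hvd⟩

/-- If an average is nearly the common upper bound, every term is nearly that bound. -/
theorem abs_le_of_sum_gt {J : Type*} [Fintype J] {t : J → ℝ} {δ ε : ℝ}
    (hsum : Fintype.card J * (δ - 2 * ε) < ∑ j, t j) (ht : ∀ j, t j ≤ δ + ε) (hε : 0 ≤ ε) (j : J) :
    δ - 3 * Fintype.card J * ε ≤ t j := by
  classical
  have h1 : ∑ i, (δ + ε - t i) < 3 * Fintype.card J * ε := by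
    rw [Finset.sum_sub_distrib]
    simp only [Finset.sum_const, Finset.card_univ, nsmul_eq_mul]
    linarith
  have h2 : δ + ε - t j ≤ ∑ i, (δ + ε - t i) :=
    Finset.single_le_sum (f := fun i => δ + ε - t i) (fun i _ => sub_nonneg.2 (ht i))
      (Finset.mem_univ j)
  linarith

/-- The step of the Hagler–Johnson construction. -/
theorem exists_simultaneous_splitting {Y : Type*} [NormedAddCommGroup Y] [NormedSpace ℝ Y]
    {T : (ℕ →₀ ℝ) →ₗ[ℝ] StrongDual ℝ Y} {z : ℕ → ℕ →₀ ℝ} {δ : ℝ} (hδ : 0 < δ)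
    (hz1 : ∀ n, finsuppL1 (z n) = 1)
    (hdisj : Pairwise fun i j => Disjoint (z i).support (z j).support)
    (hup : LimsupBound T z δ)
    (hlow : ∀ v, (∀ n, finsuppL1 (v n) = 1) → IsTailCombination v z → ∀ d, 0 ≤ d →
        LimsupBound T v d → δ ≤ d)
    {J : Type*} [Fintype J] [Nonempty J] {N : J → Set ℕ} (hN : ∀ j, (N j).Infinite)
    {s : J → ℝ} (hs : ∀ j, |s j| = 1) :
    ∃ x : Y, ‖x‖ ≤ 1 ∧ ∀ j, {n ∈ N j | δ / 2 ≤ s j * T (z n) x}.Infinite := by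
  classical
  choose a hainj haN using fun n => exists_injective_mem_of_infinite hN n
  set K : ℝ := (Fintype.card J : ℝ) with hK
  have hK1 : 1 ≤ K := by
    rw [hK]; exact_mod_cast Fintype.card_pos
  have hK0 : 0 < K := by linarith
  -- Disjoint supports keep the `ℓ¹`-norm equal to one, so stability of `δ` applies to these signed
  -- averages.
  let v : ℕ → ℕ →₀ ℝ := fun n => ∑ j, (K⁻¹ * s j) • z (a n j)
  have hv1 : ∀ n, finsuppL1 (v n) = 1 := by
    intro n
    rw [finsuppL1_sum]
    · simp [finsuppL1_smul, hz1, hs, abs_mul, abs_of_pos hK0, ← hK, hK0.ne']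
    · intro i _ j _ hij
      exact Disjoint.mono Finsupp.support_smul Finsupp.support_smul
        (hdisj ((hainj n).ne hij))
  have hvz : IsTailCombination v z := by
    intro M
    filter_upwards [eventually_ge_atTop M] with n hn
    have : v n = ∑ j, K⁻¹ • (s j • z (a n j)) := by simp [v, mul_smul]
    rw [this]
    refine convex_absConvexHull.sum_mem (fun _ _ => by positivity) ?_ fun j _ => ?_
    · simp [← hK, hK0.ne']
    · refine balanced_absConvexHull.smul_mem (by simp [hs]) (subset_absConvexHull ⟨_, ?_, rfl⟩)
      exact hn.trans (haN n j).2.le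
  have hTv : ∀ n x, K * T (v n) x = ∑ j, s j * T (z (a n j)) x := by
    intro n x
    simp only [v, map_sum, map_smul, sum_apply, smul_apply,
      smul_eq_mul, Finset.mul_sum]
    refine Finset.sum_congr rfl fun j _ => ?_
    field_simp
  -- Each term loses at most `3 * K * ε = 3δ/8`, leaving at least `δ / 2`.
  set ε := δ / (8 * K) with hε
  have hε0 : 0 < ε := by positivity
  have hεK : 8 * K * ε = δ := by rw [hε]; field_simp
  have hεδ : 2 * ε < δ := by nlinarith
  have main : ∀ x : Y, ‖x‖ ≤ 1 → (∃ᶠ n in atTop, δ - 2 * ε < T (v n) x) →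
      ∀ j, {n ∈ N j | δ / 2 ≤ s j * T (z n) x}.Infinite := by
    intro x hx hfreq j
    obtain ⟨m, hm⟩ := eventually_atTop.1 (hup x hx ε hε0)
    refine Set.infinite_of_forall_exists_gt fun k => ?_
    obtain ⟨n, hn, hkn⟩ := (hfreq.and_eventually (eventually_ge_atTop (max k m))).exists
    refine ⟨a n j, ⟨(haN n j).1, ?_⟩, ((le_max_left _ _).trans hkn).trans_lt (haN n j).2⟩
    have := abs_le_of_sum_gt (t := fun j => s j * T (z (a n j)) x) (δ := δ) (ε := ε)
      (by rw [← hTv, ← hK]; gcongr) (fun i => by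
        refine (le_abs_self _).trans ?_
        rw [abs_mul, hs, one_mul]
        exact hm _ (((le_max_right _ _).trans hkn).trans (haN n i).2.le)) hε0.le j
    rw [← hK] at this
    linarith
  have hnot : ¬ LimsupBound T v (δ - 2 * ε) := fun h => by
    have := hlow v hv1 hvz _ (by linarith) h
    linarith
  simp only [LimsupBound, not_forall, not_eventually] at hnot
  obtain ⟨x, hx, ε', hε', hfreq⟩ := hnot
  -- Stability bounds only absolute values from below; replacing `x` by `-x` fixes the sign for
  -- infinitely many `n`.
  have hor : ∃ᶠ n in atTop, (δ - 2 * ε < T (v n) x ∨ δ - 2 * ε < T (v n) (-x)) := by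
    refine hfreq.mono fun n hn => ?_
    rw [map_neg, ← lt_abs]
    linarith
  rcases frequently_or_distrib.1 hor with h | h
  · exact ⟨x, hx, main x hx h⟩
  · exact ⟨-x, by rwa [norm_neg], main (-x) (by rwa [norm_neg]) h⟩

/-- The sign attached to a Boolean. -/
def boolSign (b : Bool) : ℝ := if b then 1 else -1

theorem abs_boolSign (b : Bool) : |boolSign b| = 1 := by cases b <;> simp [boolSign]

/-- If the unit vector basis of `ℓ¹` embeds in the dual, then either the dual contains a JN-sequence
or the unit ball contains a sequence on which bounded functionals realise all sign patterns. -/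
theorem exists_isJNSequence_or_sign_patterns {Y : Type*} [NormedAddCommGroup Y]
    [NormedSpace ℝ Y] {T : (ℕ →₀ ℝ) →ₗ[ℝ] StrongDual ℝ Y} {C c : ℝ} (hc : 0 < c)
    (hT : ∀ a, ‖T a‖ ≤ C * finsuppL1 a) (hT' : ∀ a, c * finsuppL1 a ≤ ‖T a‖) :
    (∃ p : ℕ → StrongDual ℝ Y, IsJNSequence p) ∨ ∃ (x : ℕ → Y) (ε : ℝ), 0 < ε ∧
      (∀ i, ‖x i‖ ≤ 1) ∧ ∀ (σ : ℕ → Bool) (n : ℕ), ∃ φ : StrongDual ℝ Y, ‖φ‖ ≤ C ∧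
        ∀ i < n, ε ≤ boolSign (σ i) * φ (x i) := by
  obtain ⟨z, δ, hz1, hze, hδ0, hup, hlow⟩ := exists_stable_limsupBound hT
  rcases hδ0.eq_or_lt with rfl | hδ
  · left
    -- A zero limsup bound on the unit ball is weak*-nullity, and `hT'` keeps the norms at least
    -- `c`.
    refine ⟨fun n => T (z n), IsWeakStarNull.isJNSequence ?_ hc fun n => ?_⟩
    · rw [isWeakStarNull_iff]
      intro x
      have hpos : 0 < ‖x‖ + 1 := by positivity
      rw [Metric.tendsto_atTop]
      intro ε hε
      have hx : ‖(‖x‖ + 1)⁻¹ • x‖ ≤ 1 := by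
        rw [norm_smul, norm_inv, Real.norm_of_nonneg hpos.le, inv_mul_le_iff₀ hpos]
        linarith
      obtain ⟨N, hN⟩ := eventually_atTop.1
        (hup _ hx (ε / (2 * (‖x‖ + 1))) (by positivity))
      refine ⟨N, fun n hn => ?_⟩
      have := hN n hn
      rw [map_smul, smul_eq_mul, abs_mul, abs_of_pos (inv_pos.2 hpos), zero_add,
        inv_mul_le_iff₀ hpos] at this
      rw [Real.dist_eq, sub_zero]
      refine this.trans_lt ?_
      field_simp
      linarith
    · simpa [hz1 n] using hT' (z n)
  right
  obtain ⟨φ, hφ, hdisj⟩ := hze.exists_disjoint_subsequence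
  have hφz := IsTailCombination.comp_strictMono z hφ
  obtain ⟨x, hx⟩ := exists_dyadic_tree (X := {x : Y // ‖x‖ ≤ 1})
    (S := fun x b => {n | δ / 2 ≤ boolSign b * T (z (φ n)) x}) (fun 𝒩 hfin hinf => by
      rcases 𝒩.eq_empty_or_nonempty with rfl | ⟨N₀, hN₀⟩
      · exact ⟨⟨0, by simp⟩, by simp⟩
      have := hfin.fintype
      have : Nonempty 𝒩 := ⟨⟨N₀, hN₀⟩⟩
      obtain ⟨x, hx, h⟩ := exists_simultaneous_splitting (z := z ∘ φ) hδ (fun n => hz1 _) hdisj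
        (hup.of_isTailCombination hφz) (fun v hv hvz => hlow v hv (hvz.trans hφz))
        (J := 𝒩 × Bool) (N := fun j => j.1) (fun j => hinf _ j.1.2)
        (s := fun j => boolSign j.2) (fun j => abs_boolSign _)
      exact ⟨⟨x, hx⟩, fun N hN b => h (⟨N, hN⟩, b)⟩)
  refine ⟨fun i => x i, δ / 2, half_pos hδ, fun i => (x i).2, fun σ n => ?_⟩
  obtain ⟨m, hm⟩ := (hx σ n).nonempty
  exact ⟨T (z (φ m)), by simpa [hz1] using hT (z (φ m)), hm⟩

/-! ### Rademacher averaging and the Josefson–Nissenzweig theorem. -/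

/-- Orthogonality of the Rademacher functions: for `i ≠ j`, flipping the `i`-th sign cancels terms
in pairs. -/
theorem sum_boolSign_mul_boolSign {n : ℕ} (i j : Fin n) :
    ∑ σ : Fin n → Bool, boolSign (σ i) * boolSign (σ j) = if i = j then 2 ^ n else 0 := by
  have hsq : ∀ b, boolSign b * boolSign b = 1 := fun b => by cases b <;> simp [boolSign]
  split_ifs with h
  · subst h
    simp [hsq]
  · refine Finset.sum_involution (fun σ _ => Function.update σ i (!σ i)) ?_ ?_ ?_ ?_
    · intro σ _
      rw [Function.update_self, Function.update_of_ne (Ne.symm h)]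
      cases σ i <;> cases σ j <;> simp [boolSign]
    · intro σ _ _ heq
      have := congrFun heq i
      simp at this
    · simp
    · intro σ _
      simp

/-- Bessel's inequality for the Rademacher functions on `{±1}ⁿ`. -/
theorem sum_sq_rademacher_le {n : ℕ} (g : (Fin n → Bool) → ℝ) {B : ℝ} (hg : ∀ σ, |g σ| ≤ B) :
    ∑ i, ((2 ^ n)⁻¹ * ∑ σ, boolSign (σ i) * g σ) ^ 2 ≤ B ^ 2 := by
  set c : Fin n → ℝ := fun i => (2 ^ n)⁻¹ * ∑ σ, boolSign (σ i) * g σ with hc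
  have hcs : ∀ i, ∑ σ, boolSign (σ i) * g σ = 2 ^ n * c i := fun i => by
    simp [hc]
  have h0 : 0 ≤ ∑ σ, (g σ - ∑ i, c i * boolSign (σ i)) ^ 2 :=
    Finset.sum_nonneg fun _ _ => sq_nonneg _
  have h1 : ∑ σ, g σ * ∑ i, c i * boolSign (σ i) = 2 ^ n * ∑ i, c i ^ 2 := by
    simp only [Finset.mul_sum]
    rw [Finset.sum_comm]
    refine Finset.sum_congr rfl fun i _ => ?_
    have : ∀ σ, g σ * (c i * boolSign (σ i)) = c i * (boolSign (σ i) * g σ) := fun σ => by ring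
    simp only [this]
    rw [← Finset.mul_sum, hcs]
    ring
  have h2 : ∑ σ : Fin n → Bool, (∑ i, c i * boolSign (σ i)) ^ 2 = 2 ^ n * ∑ i, c i ^ 2 := by
    simp only [sq, Finset.sum_mul_sum]
    rw [Finset.sum_comm]
    rw [Finset.mul_sum]
    refine Finset.sum_congr rfl fun i _ => ?_
    rw [Finset.sum_comm]
    have : ∀ j, ∑ σ : Fin n → Bool, c i * boolSign (σ i) * (c j * boolSign (σ j)) =
        c i * c j * if i = j then 2 ^ n else 0 := by
      intro j
      rw [← sum_boolSign_mul_boolSign, Finset.mul_sum]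
      exact Finset.sum_congr rfl fun σ _ => by ring
    simp only [this]
    simp
    ring
  have h3 : ∑ σ, g σ ^ 2 ≤ 2 ^ n * B ^ 2 := by
    calc ∑ σ, g σ ^ 2 ≤ ∑ _σ : Fin n → Bool, B ^ 2 :=
          Finset.sum_le_sum fun σ _ => sq_le_sq' (abs_le.1 (hg σ)).1 (abs_le.1 (hg σ)).2
      _ = 2 ^ n * B ^ 2 := by simp
  have h4 : ∑ σ, (g σ - ∑ i, c i * boolSign (σ i)) ^ 2 =
      ∑ σ, g σ ^ 2 - 2 * (∑ σ, g σ * ∑ i, c i * boolSign (σ i)) +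
        ∑ σ : Fin n → Bool, (∑ i, c i * boolSign (σ i)) ^ 2 := by
    rw [Finset.mul_sum, ← Finset.sum_sub_distrib, ← Finset.sum_add_distrib]
    exact Finset.sum_congr rfl fun σ _ => by ring
  rw [h4, h1, h2] at h0
  have hpos : (0 : ℝ) < 2 ^ n := by positivity
  nlinarith

theorem exists_isJNSequence_of_sign_patterns {Y : Type*} [NormedAddCommGroup Y]
    [NormedSpace ℝ Y] {x : ℕ → Y} {C ε : ℝ} (hε : 0 < ε) (hx : ∀ i, ‖x i‖ ≤ 1)
    (h : ∀ (σ : ℕ → Bool) (n : ℕ), ∃ φ : StrongDual ℝ Y, ‖φ‖ ≤ C ∧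
        ∀ i < n, ε ≤ boolSign (σ i) * φ (x i)) :
    ∃ p : ℕ → StrongDual ℝ Y, IsJNSequence p := by
  have hC : 0 ≤ C := by
    obtain ⟨φ, hφ, -⟩ := h (fun _ => true) 0
    exact (norm_nonneg _).trans hφ
  have h' : ∀ (n : ℕ) (σ : Fin n → Bool), ∃ φ : StrongDual ℝ Y, ‖φ‖ ≤ C ∧
      ∀ i, ε ≤ boolSign (σ i) * φ (x i) := by
    intro n σ
    obtain ⟨φ, hφ, hφ'⟩ := h (fun i => if hi : i < n then σ ⟨i, hi⟩ else true) n
    exact ⟨φ, hφ, fun i => by simpa using hφ' i i.2⟩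
  choose φ hφ hφx using h'
  -- At each `y`, these are the Rademacher coefficients of `σ ↦ φ n σ y`, so Bessel bounds their sum
  -- of squares independently of `n`.
  let p : ℕ → ℕ → StrongDual ℝ Y := fun n i =>
    if hi : i < n then ((2 : ℝ) ^ n)⁻¹ • ∑ σ : Fin n → Bool, boolSign (σ ⟨i, hi⟩) • φ n σ else 0
  have hp : ∀ n (i : Fin n) y, p n i y =
      ((2 : ℝ) ^ n)⁻¹ * ∑ σ : Fin n → Bool, boolSign (σ i) * φ n σ y := by
    intro n i y
    simp [p, i.2]
  have hbessel : ∀ n y, ∑ i : Fin n, (p n i y) ^ 2 ≤ (C * ‖y‖) ^ 2 := by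
    intro n y
    simp only [hp]
    refine sum_sq_rademacher_le (fun σ => φ n σ y) fun σ => ?_
    exact ((φ n σ).le_opNorm y).trans (by gcongr; exact hφ n σ)
  have hdiag : ∀ n (i : Fin n), ε ≤ p n i (x i) := by
    intro n i
    rw [hp, le_inv_mul_iff₀ (by positivity)]
    calc 2 ^ n * ε = ∑ _σ : Fin n → Bool, ε := by simp
      _ ≤ _ := Finset.sum_le_sum fun σ _ => hφx n σ i
  have hnorm : ∀ n i, ‖p n i‖ ≤ C := by
    intro n i
    refine ContinuousLinearMap.opNorm_le_bound _ hC fun y => ?_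
    by_cases hi : i < n
    · rw [Real.norm_eq_abs]
      refine abs_le_of_sq_le_sq ?_ (by positivity)
      refine le_trans ?_ (hbessel n y)
      exact Finset.single_le_sum (f := fun i : Fin n => (p n i y) ^ 2)
        (fun _ _ => sq_nonneg _) (Finset.mem_univ ⟨i, hi⟩)
    · simp only [p, dif_neg hi, zero_apply, norm_zero]
      positivity
  -- One ultrafilter serves all `i`, so the bounds on finite sums of squares survive in the limit.
  let U : Ultrafilter ℕ := hyperfilter ℕ
  have hUle : (U : Filter ℕ) ≤ atTop := by
    rw [← Nat.cofinite_eq_atTop]; exact hyperfilter_le_cofinite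
  have hlim : ∀ i, ∃ q : WeakDual ℝ Y,
      Tendsto (fun n => StrongDual.toWeakDual (p n i)) U (𝓝 q) := by
    intro i
    obtain ⟨q, -, hq⟩ := (WeakDual.isCompact_closedBall (𝕜 := ℝ) (0 : StrongDual ℝ Y) C
      ).ultrafilter_le_nhds (U.map fun n => StrongDual.toWeakDual (p n i)) (by
        rw [le_principal_iff]
        refine Filter.mem_map.2 (Eventually.of_forall fun n => ?_)
        simpa using hnorm n i)
    exact ⟨q, hq⟩
  choose q hq using hlim
  have hq' : ∀ i y, Tendsto (fun n => p n i y) U (𝓝 (q i y)) := fun i y =>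
    ((WeakDual.eval_continuous y).tendsto (q i)).comp (hq i)
  have hsum : ∀ y m, ∑ i ∈ Finset.range m, (q i y) ^ 2 ≤ (C * ‖y‖) ^ 2 := by
    intro y m
    refine le_of_tendsto (tendsto_finsetSum (Finset.range m) fun i _ => (hq' i y).pow 2)
      (hUle (eventually_ge_atTop m) |> Eventually.mono <| fun n hn => ?_)
    have hb := hbessel n y
    rw [Fin.sum_univ_eq_sum_range (fun i => (p n i y) ^ 2) n] at hb
    refine le_trans (Finset.sum_le_sum_of_subset_of_nonneg ?_ fun _ _ _ => sq_nonneg _) hb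
    exact Finset.range_mono hn
  refine ⟨fun i => WeakDual.toStrongDual (q i),
    IsWeakStarNull.isJNSequence (isWeakStarNull_iff.2 fun y => ?_) hε fun i => ?_⟩
  · have hs : Summable fun i => (q i y) ^ 2 :=
      summable_of_sum_range_le (fun _ => sq_nonneg _) (hsum y)
    have := hs.tendsto_atTop_zero.sqrt
    simp only [Real.sqrt_sq_eq_abs, Real.sqrt_zero] at this
    exact tendsto_zero_iff_abs_tendsto_zero _ |>.2 this
  · have hle : ε ≤ q i (x i) :=
      ge_of_tendsto (hq' i (x i))
        (hUle (eventually_gt_atTop i) |> Eventually.mono <| fun n hn => hdiag n ⟨i, hn⟩)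
    calc ε ≤ WeakDual.toStrongDual (q i) (x i) := hle
      _ ≤ ‖WeakDual.toStrongDual (q i)‖ * ‖x i‖ :=
        (le_abs_self _).trans ((WeakDual.toStrongDual (q i)).le_opNorm _)
      _ ≤ ‖WeakDual.toStrongDual (q i)‖ := mul_le_of_le_one_right (norm_nonneg _) (hx i)

theorem finiteDimensional_of_finiteDimensional_strongDual {Y : Type*} [NormedAddCommGroup Y]
    [NormedSpace ℝ Y] [FiniteDimensional ℝ (StrongDual ℝ Y)] : FiniteDimensional ℝ Y :=
  FiniteDimensional.of_injective (NormedSpace.inclusionInDoubleDualLi ℝ (E := Y)).toLinearMap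
    (NormedSpace.inclusionInDoubleDualLi ℝ (E := Y)).injective

/-- The Josefson–Nissenzweig theorem. -/
theorem exists_isJNSequence_of_not_finiteDimensional {Y : Type*} [NormedAddCommGroup Y]
    [NormedSpace ℝ Y] (h : ¬ FiniteDimensional ℝ Y) :
    ∃ p : ℕ → StrongDual ℝ Y, IsJNSequence p := by
  -- The dual is infinite dimensional because `Y` embeds in its bidual; Riesz's lemma gives the
  -- separated sequence.
  obtain ⟨R, f, -, hR, hsep⟩ := exists_seq_norm_le_one_le_norm_sub (𝕜 := ℝ)
    (E := StrongDual ℝ Y) (fun _ => h finiteDimensional_of_finiteDimensional_strongDual)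
  rcases exists_pointwise_tendsto_or_lower_l1 hR with ⟨φ, hφ, hconv⟩ | ⟨φ, c, hc, hlow⟩
  · refine ⟨fun n => f (φ (n + 1)) - f (φ n),
      IsWeakStarNull.isJNSequence (isWeakStarNull_iff.2 fun x => ?_) one_pos fun n => ?_⟩
    · obtain ⟨l, hl⟩ := hconv x
      simpa using (hl.comp (tendsto_add_atTop_nat 1)).sub hl
    · exact hsep (hφ (Nat.lt_succ_self n)).ne'
  · have hup : ∀ a : ℕ →₀ ℝ,
        ‖Finsupp.linearCombination ℝ (fun n => f (φ n)) a‖ ≤ R * finsuppL1 a := by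
      intro a
      rw [Finsupp.linearCombination_apply, finsuppL1, Finsupp.sum, Finsupp.sum, Finset.mul_sum]
      refine norm_sum_le_of_le _ fun i _ => ?_
      rw [norm_smul, Real.norm_eq_abs, mul_comm]
      gcongr
      exact hR _
    rcases exists_isJNSequence_or_sign_patterns hc hup hlow with hJN | ⟨x, ε, hε, hx, hpat⟩
    · exact hJN
    · exact exists_isJNSequence_of_sign_patterns hε hx hpat

/-! ### Finite-dimensional converses and non-limited operators. -/

section

variable {Y : Type*} [NormedAddCommGroup Y] [NormedSpace ℝ Y]

theorem WeakDual.tendsto_iff_forall_apply {ι : Type*} {l : Filter ι} {p : ι → WeakDual ℝ Y}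
    {q : WeakDual ℝ Y} : Tendsto p l (𝓝 q) ↔ ∀ y, Tendsto (fun n => p n y) l (𝓝 (q y)) :=
  tendsto_iff_forall_eval_tendsto_topDualPairing

theorem WeakDual.continuous_toStrongDual_of_finiteDimensional [FiniteDimensional ℝ Y] :
    Continuous (WeakDual.toStrongDual : WeakDual ℝ Y → StrongDual ℝ Y) := by
  have : FiniteDimensional ℝ (WeakDual ℝ Y) :=
    (WeakDual.toStrongDual (𝕜 := ℝ) (E := Y)).symm.finiteDimensional
  exact LinearMap.continuous_of_finiteDimensional
    (WeakDual.toStrongDual (𝕜 := ℝ) (E := Y)).toLinearMap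

theorem IsWeakStarNull.tendsto_zero [FiniteDimensional ℝ Y] {p : ℕ → StrongDual ℝ Y}
    (h : IsWeakStarNull p) : Tendsto p atTop (𝓝 0) := by
  have := (WeakDual.continuous_toStrongDual_of_finiteDimensional.tendsto
    (0 : WeakDual ℝ Y)).comp h
  rwa [map_zero] at this

theorem IsJNSequence.exists_pos_le {p : ℕ → StrongDual ℝ Y} (h : IsJNSequence p) :
    ∃ c, 0 < c ∧ ∀ n, c ≤ ‖p n‖ :=
  ⟨_, h.2, fun n => ciInf_le ⟨0, by rintro _ ⟨n, rfl⟩; exact norm_nonneg _⟩ n⟩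

theorem IsJNSequence.not_tendsto_zero {p : ℕ → StrongDual ℝ Y} (h : IsJNSequence p) :
    ¬ Tendsto p atTop (𝓝 0) := by
  intro h0
  obtain ⟨c, hc, hp⟩ := h.exists_pos_le
  have := ge_of_tendsto' h0.norm hp
  simp only [norm_zero] at this
  linarith

theorem HasStrongMinOn.of_weakStar [FiniteDimensional ℝ Y] {K : Set (StrongDual ℝ Y)}
    {h : StrongDual ℝ Y → ℝ} (hK : HasStrongMinOn (weakStarFun h) (weakStarSet K) 0) :
    HasStrongMinOn h K 0 := by
  obtain ⟨h0, hmin, hlim⟩ := hK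
  refine ⟨h0, fun q hq => hmin (a := StrongDual.toWeakDual q) hq, fun p hp hpt => ?_⟩
  exact IsWeakStarNull.tendsto_zero (hlim (fun n => StrongDual.toWeakDual (p n)) hp hpt)

theorem isLimitedOperator_of_finiteDimensional [FiniteDimensional ℝ Y] {X : Type*}
    [NormedAddCommGroup X] [NormedSpace ℝ X] (T : Y →L[ℝ] X) : IsLimitedOperator T := by
  intro p hp
  have hq : IsWeakStarNull fun n => (p n).comp T :=
    isWeakStarNull_iff.2 fun y => isWeakStarNull_iff.1 hp (T y)
  have hq0 := hq.tendsto_zero.norm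
  rw [Metric.tendstoUniformlyOn_iff]
  intro ε hε
  rw [norm_zero] at hq0
  filter_upwards [hq0.eventually_lt_const hε] with n hn
  rintro _ ⟨y, hy, rfl⟩
  rw [dist_zero_left]
  calc ‖p n (T y)‖ ≤ ‖(p n).comp T‖ * ‖y‖ := ((p n).comp T).le_opNorm y
    _ ≤ ‖(p n).comp T‖ := mul_le_of_le_one_right (norm_nonneg _) (mem_closedBall_zero_iff.1 hy)
    _ < ε := hn

theorem IsJNSequence.not_isLimitedOperator {p : ℕ → StrongDual ℝ Y} (hp : IsJNSequence p)
    {X : Type*} [NormedAddCommGroup X] [NormedSpace ℝ X] (e : Y ≃L[ℝ] X) :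
    ¬ IsLimitedOperator (e : Y →L[ℝ] X) := by
  intro h
  have hq : IsWeakStarNull fun n => (p n).comp (e.symm : X →L[ℝ] Y) :=
    isWeakStarNull_iff.2 fun y => isWeakStarNull_iff.1 hp.1 (e.symm y)
  obtain ⟨c, hc, hle⟩ := hp.exists_pos_le
  obtain ⟨n, hn⟩ := (Metric.tendstoUniformlyOn_iff.1 (h _ hq) (c / 2) (half_pos hc)).exists
  have : ‖p n‖ ≤ c / 2 := by
    refine ContinuousLinearMap.opNorm_le_of_unit_norm (half_pos hc).le fun y hy => ?_
    have := hn (e y) ⟨y, by simp [hy], rfl⟩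
    rw [dist_zero_left] at this
    simpa using this.le
  linarith [hle n]

/-- In finite dimension a convex function is locally Lipschitz, and for Lipschitz functions line
derivatives given by a continuous linear functional yield a Fréchet derivative. The local Lipschitz
function is first extended globally. -/
theorem ConvexOn.differentiableAt_of_gateauxDifferentiableAt [FiniteDimensional ℝ Y] {f : Y → ℝ}
    (hf : ConvexOn ℝ Set.univ f) {y : Y} (h : GateauxDifferentiableAt f y) :
    DifferentiableAt ℝ f y := by
  obtain ⟨Q, hQ⟩ := h
  obtain ⟨C, t, ht, hLip⟩ := hf.locallyLipschitzOn isOpen_univ (Set.mem_univ y)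
  rw [nhdsWithin_univ] at ht
  obtain ⟨g, hg, hfg⟩ := hLip.extend_real
  have heq : f =ᶠ[𝓝 y] g := by
    filter_upwards [ht] with z hz using hfg hz
  have hgQ : HasFDerivAt g Q y := by
    refine hg.hasFDerivAt_of_hasLineDerivAt_of_closure (s := Set.univ) (by simp) fun v _ => ?_
    have hc : Tendsto (fun t : ℝ => y + t • v) (𝓝 0) (𝓝 y) := by
      have : Continuous fun t : ℝ => y + t • v := by fun_prop
      simpa using this.tendsto 0
    exact HasDerivAt.congr_of_eventuallyEq (hQ v) ((hc.eventually heq).mono fun t ht => ht.symm)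
  exact (hgQ.congr_of_eventuallyEq heq).differentiableAt

theorem exists_norm_le_of_forall_tendsto [CompleteSpace Y] {p : ℕ → StrongDual ℝ Y}
    {q : Y → ℝ} (h : ∀ y, Tendsto (fun n => p n y) atTop (𝓝 (q y))) :
    ∃ C, 0 ≤ C ∧ ∀ n, ‖p n‖ ≤ C := by
  obtain ⟨C, hC⟩ := banach_steinhaus (g := p) fun y => by
    obtain ⟨C, hC⟩ := (h y).norm.bddAbove_range
    exact ⟨C, fun n => hC ⟨n, rfl⟩⟩
  exact ⟨C, (norm_nonneg _).trans (hC 0), hC⟩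

/-! ### A convex function Gâteaux but not Fréchet differentiable at `0`. -/

/-- The function `supₙ (pₙ y - 1/(n+1))⁺`. -/
noncomputable def supTruncated (p : ℕ → StrongDual ℝ Y) (y : Y) : ℝ :=
  ⨆ n : ℕ, max 0 (p n y - 1 / ((n : ℝ) + 1))

theorem max_zero_sub_le {p : ℕ → StrongDual ℝ Y} {C : ℝ} (hC : ∀ n, ‖p n‖ ≤ C)
    (n : ℕ) (y : Y) : max 0 (p n y - 1 / ((n : ℝ) + 1)) ≤ C * ‖y‖ := by
  have hC0 : 0 ≤ C := (norm_nonneg _).trans (hC 0)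
  refine max_le (by positivity) ?_
  have h1 : p n y ≤ C * ‖y‖ := (le_abs_self _).trans
    (((p n).le_opNorm y).trans (by gcongr; exact hC n))
  have h2 : (0 : ℝ) < 1 / ((n : ℝ) + 1) := by positivity
  linarith

theorem le_supTruncated {p : ℕ → StrongDual ℝ Y} {C : ℝ} (hC : ∀ n, ‖p n‖ ≤ C)
    (n : ℕ) (y : Y) : max 0 (p n y - 1 / ((n : ℝ) + 1)) ≤ supTruncated p y :=
  le_ciSup (f := fun n : ℕ => max 0 (p n y - 1 / ((n : ℝ) + 1)))
    ⟨C * ‖y‖, by rintro _ ⟨n, rfl⟩; exact max_zero_sub_le hC n y⟩ n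

theorem supTruncated_nonneg {p : ℕ → StrongDual ℝ Y} (y : Y) : 0 ≤ supTruncated p y :=
  Real.iSup_nonneg fun _ => le_max_left _ _

theorem convexOn_supTruncated {p : ℕ → StrongDual ℝ Y} {C : ℝ} (hC : ∀ n, ‖p n‖ ≤ C) :
    ConvexOn ℝ Set.univ (supTruncated p) := by
  refine ⟨convex_univ, fun x _ y _ a b ha hb hab => ciSup_le fun n => max_le ?_ ?_⟩
  · have h1 := supTruncated_nonneg (p := p) x
    have h2 := supTruncated_nonneg (p := p) y
    simp only [smul_eq_mul]
    positivity
  · have h1 := (le_max_right _ _).trans (le_supTruncated hC n x)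
    have h2 := (le_max_right _ _).trans (le_supTruncated hC n y)
    simp only [map_add, map_smul, smul_eq_mul]
    calc a * p n x + b * p n y - 1 / ((n : ℝ) + 1)
        = a * p n x + b * p n y - (a + b) * (1 / ((n : ℝ) + 1)) := by rw [hab, one_mul]
      _ = a * (p n x - 1 / ((n : ℝ) + 1)) + b * (p n y - 1 / ((n : ℝ) + 1)) := by ring
      _ ≤ _ := by gcongr

theorem continuous_supTruncated {p : ℕ → StrongDual ℝ Y} {C : ℝ} (hC : ∀ n, ‖p n‖ ≤ C) :
    Continuous (supTruncated p) := by
  have hC0 : 0 ≤ C := (norm_nonneg _).trans (hC 0)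
  refine (LipschitzWith.of_le_add_mul ⟨C, hC0⟩ fun x y => ciSup_le fun n => ?_).continuous
  have h0 := supTruncated_nonneg (p := p) y
  have h1 := (le_max_right _ _).trans (le_supTruncated hC n y)
  have h2 : p n x - p n y ≤ C * dist x y := by
    rw [← map_sub, dist_eq_norm]
    exact (le_abs_self _).trans (((p n).le_opNorm _).trans (by gcongr; exact hC n))
  have h3 : 0 ≤ C * dist x y := by positivity
  refine max_le (add_nonneg h0 h3) ?_
  change _ ≤ supTruncated p y + C * dist x y
  linarith

theorem supTruncated_zero (p : ℕ → StrongDual ℝ Y) : supTruncated p 0 = 0 := by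
  refine le_antisymm (ciSup_le fun n => max_le le_rfl ?_) (supTruncated_nonneg _)
  simp only [map_zero, zero_sub, Left.neg_nonpos_iff]
  positivity

theorem hasLineDerivAt_supTruncated {p : ℕ → StrongDual ℝ Y} (hp : IsWeakStarNull p) {C : ℝ}
    (hC : ∀ n, ‖p n‖ ≤ C) (v : Y) : HasLineDerivAt ℝ (supTruncated p) 0 0 v := by
  have hC0 : 0 ≤ C := (norm_nonneg _).trans (hC 0)
  rw [HasLineDerivAt, hasDerivAt_iff_isLittleO, Asymptotics.isLittleO_iff]
  intro η hη
  obtain ⟨N, hN⟩ := eventually_atTop.1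
    ((isWeakStarNull_iff.1 hp v).abs.eventually_le_const (by simpa using hη))
  have hD : 0 < C * ‖v‖ + 1 := by positivity
  -- For smaller `|t|` the truncation kills the terms with `n < N`; the others are at most `η |t|`
  -- by the choice of `N`.
  have hτ : (0 : ℝ) < 1 / ((N : ℝ) + 1) / (C * ‖v‖ + 1) := by positivity
  filter_upwards [Metric.ball_mem_nhds (0 : ℝ) hτ] with t ht
  rw [mem_ball_zero_iff, Real.norm_eq_abs, lt_div_iff₀ hD] at ht
  simp only [zero_add, zero_smul, supTruncated_zero, sub_zero, smul_zero, Real.norm_eq_abs,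
    abs_of_nonneg (supTruncated_nonneg _)]
  refine ciSup_le fun n => max_le (by positivity) ?_
  rw [map_smul, smul_eq_mul]
  have hpos : (0 : ℝ) < 1 / ((n : ℝ) + 1) := by positivity
  have habs : t * p n v ≤ |t| * |p n v| := by rw [← abs_mul]; exact le_abs_self _
  have ht0 := abs_nonneg t
  rcases le_or_gt N n with hn | hn
  · have := mul_le_mul_of_nonneg_left (hN n hn) ht0
    linarith
  · have h1 : |p n v| ≤ C * ‖v‖ := ((p n).le_opNorm v).trans (by gcongr; exact hC n)
    have h2 := mul_le_mul_of_nonneg_left h1 ht0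
    have h3 : 1 / ((N : ℝ) + 1) ≤ 1 / ((n : ℝ) + 1) := by gcongr
    nlinarith [mul_nonneg hη.le ht0]

theorem not_differentiableAt_supTruncated {p : ℕ → StrongDual ℝ Y} (hp : IsJNSequence p) {C : ℝ}
    (hC : ∀ n, ‖p n‖ ≤ C) : ¬ DifferentiableAt ℝ (supTruncated p) 0 := by
  intro hd
  obtain ⟨c, hc, hle⟩ := hp.exists_pos_le
  have hA := hd.hasFDerivAt
  have hA0 : fderiv ℝ (supTruncated p) 0 = 0 := by
    ext v
    exact (hA.hasLineDerivAt v).unique (hasLineDerivAt_supTruncated hp.1 hC v)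
  rw [hA0, hasFDerivAt_iff_isLittleO_nhds_zero, Asymptotics.isLittleO_iff] at hA
  obtain ⟨ρ, hρ, hball⟩ := Metric.eventually_nhds_iff.1 (hA (c := c / 8) (by positivity))
  obtain ⟨n, hn⟩ := exists_nat_one_div_lt (K := ℝ) (mul_pos hρ (by positivity : 0 < c / 4))
  obtain ⟨v, hv, hpv⟩ : ∃ v, ‖v‖ < 1 ∧ c / 2 < p n v := by
    obtain ⟨v, hv, hpv⟩ := (p n).exists_lt_apply_of_lt_opNorm
      (show c / 2 < ‖p n‖ by linarith [hle n])
    rcases lt_abs.1 hpv with h | h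
    · exact ⟨v, hv, h⟩
    · exact ⟨-v, by rwa [norm_neg], by rwa [map_neg]⟩
  set e : ℝ := 1 / ((n : ℝ) + 1) with he
  have he0 : 0 < e := by positivity
  -- At this scale the `n`-th term exceeds `2e - e = e`, whereas Fréchet differentiability with
  -- constant `c / 8` allows at most `e / 2`.
  have hs0 : 0 < 4 * e / c := by positivity
  have hnorm : ‖(4 * e / c) • v‖ ≤ 4 * e / c := by
    rw [norm_smul, Real.norm_of_nonneg hs0.le]
    exact mul_le_of_le_one_right hs0.le hv.le
  have hlt : 4 * e / c < ρ := by
    rw [div_lt_iff₀ hc]; linarith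
  have h1 := hball (y := (4 * e / c) • v) (by rw [dist_zero_right]; exact hnorm.trans_lt hlt)
  simp only [zero_add, supTruncated_zero, sub_zero, zero_apply, Real.norm_eq_abs,
    abs_of_nonneg (supTruncated_nonneg _)] at h1
  have h2 := (le_max_right _ _).trans (le_supTruncated hC n ((4 * e / c) • v))
  rw [← he, map_smul, smul_eq_mul] at h2
  have h3 : 4 * e / c * (c / 2) < 4 * e / c * p n v := by gcongr
  have h4 : 4 * e / c * (c / 2) = 2 * e := by field_simp; ring
  have h5 : c / 8 * ‖(4 * e / c) • v‖ ≤ c / 8 * (4 * e / c) := by gcongr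
  have h6 : c / 8 * (4 * e / c) = e / 2 := by field_simp; ring
  linarith

/-! ### The seminorm and the weak*-compact convex set. -/

/-- The points `x n` nearly norm a dense sequence `d n`. If `z` vanished at all of them, any `d n`
close to `z` would have norm too small to approximate a nonzero `z`. -/
theorem exists_seq_separating_of_isSeparable {Z : Submodule ℝ (StrongDual ℝ Y)}
    (hZ : TopologicalSpace.IsSeparable (Z : Set (StrongDual ℝ Y))) :
    ∃ x : ℕ → Y, (∀ n, ‖x n‖ ≤ 1) ∧ ∀ z ∈ Z, (∀ n, z (x n) = 0) → z = 0 := by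
  obtain ⟨D, hD, hZD⟩ := hZ
  have hDne : D.Nonempty := closure_nonempty_iff.1 ⟨0, hZD Z.zero_mem⟩
  obtain ⟨d, rfl⟩ := hD.exists_eq_range hDne
  have : ∀ n, ∃ x : Y, ‖x‖ ≤ 1 ∧ ‖d n‖ / 2 ≤ |d n x| := by
    intro n
    rcases eq_or_ne (d n) 0 with h | h
    · exact ⟨0, by simp [h]⟩
    · obtain ⟨x, hx, hlt⟩ := (d n).exists_lt_apply_of_lt_opNorm
        (half_lt_self (norm_pos_iff.2 h))
      exact ⟨x, hx.le, hlt.le⟩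
  choose x hx hdx using this
  refine ⟨x, hx, fun z hz h0 => ?_⟩
  by_contra hne
  have hpos : 0 < ‖z‖ := norm_pos_iff.2 hne
  obtain ⟨_, ⟨n, rfl⟩, hn⟩ := Metric.mem_closure_iff.1 (hZD hz) (‖z‖ / 4) (by positivity)
  rw [dist_eq_norm] at hn
  have h1 : |d n (x n)| ≤ ‖z - d n‖ := by
    have : d n (x n) = -((z - d n) (x n)) := by simp [h0]
    rw [this, abs_neg]
    exact ((z - d n).le_opNorm _).trans (mul_le_of_le_one_right (norm_nonneg _) (hx n))
  have h2 := norm_le_norm_add_norm_sub' z (d n)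
  linarith [hdx n]

theorem summable_weighted_eval {x : ℕ → Y} (hx : ∀ n, ‖x n‖ ≤ 1) (q : StrongDual ℝ Y) :
    Summable fun n => (1 / 2 : ℝ) ^ n * |q (x n)| := by
  refine Summable.of_nonneg_of_le (fun n => by positivity) (fun n => ?_)
    (summable_geometric_two.mul_right ‖q‖)
  gcongr
  exact (q.le_opNorm _).trans (mul_le_of_le_one_right (norm_nonneg _) (hx n))

/-- The seminorm `∑ 2⁻ⁿ |q (xₙ)|` on the dual. -/
noncomputable def weightedEvalSeminorm {x : ℕ → Y} (hx : ∀ n, ‖x n‖ ≤ 1) :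
    Seminorm ℝ (StrongDual ℝ Y) :=
  Seminorm.of (fun q => ∑' n, (1 / 2 : ℝ) ^ n * |q (x n)|)
    (fun p q => by
      rw [← (summable_weighted_eval hx p).tsum_add (summable_weighted_eval hx q)]
      refine (summable_weighted_eval hx _).tsum_le_tsum (fun n => ?_)
        ((summable_weighted_eval hx p).add (summable_weighted_eval hx q))
      rw [← mul_add]
      gcongr
      exact abs_add_le _ _)
    (fun t q => by
      rw [← tsum_mul_left]
      refine tsum_congr fun n => ?_
      simp only [smul_apply, smul_eq_mul, abs_mul, Real.norm_eq_abs]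
      ring)

theorem continuous_weightedEvalSeminorm {x : ℕ → Y} (hx : ∀ n, ‖x n‖ ≤ 1) :
    Continuous (weightedEvalSeminorm hx) := by
  refine Seminorm.continuous_of_le (q := (2 : NNReal) • normSeminorm ℝ (StrongDual ℝ Y))
    (show Continuous fun q : StrongDual ℝ Y => (2 : ℝ) * ‖q‖ by fun_prop) fun q => ?_
  change ∑' n, (1 / 2 : ℝ) ^ n * |q (x n)| ≤ 2 * ‖q‖
  refine ((summable_weighted_eval hx q).tsum_le_tsum (fun n => ?_)
    (summable_geometric_two.mul_right ‖q‖)).trans_eq (by rw [tsum_mul_right, tsum_geometric_two])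
  gcongr
  exact (q.le_opNorm _).trans (mul_le_of_le_one_right (norm_nonneg _) (hx n))

theorem lowerSemicontinuous_weightedEvalSeminorm {x : ℕ → Y} (hx : ∀ n, ‖x n‖ ≤ 1) :
    LowerSemicontinuous (weakStarFun (weightedEvalSeminorm hx)) := by
  intro q y hy
  have hs := summable_weighted_eval hx (WeakDual.toStrongDual q)
  obtain ⟨N, hN⟩ := (hs.hasSum.tendsto_sum_nat.eventually_const_lt hy).exists
  have hcont : Continuous fun q : WeakDual ℝ Y =>
      ∑ n ∈ Finset.range N, (1 / 2 : ℝ) ^ n * |q (x n)| := by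
    refine continuous_finsetSum _ fun n _ => ?_
    exact continuous_const.mul (WeakDual.eval_continuous (x n)).abs
  filter_upwards [(hcont.tendsto q).eventually_const_lt hN] with q' hq'
  exact hq'.trans_le ((summable_weighted_eval hx (WeakDual.toStrongDual q')).sum_le_tsum _
    fun n _ => by positivity)

/-- Weak*-convergent sequences are bounded by Banach–Steinhaus, so dominated convergence applies to
the series. -/
theorem seqContinuous_weightedEvalSeminorm [CompleteSpace Y] {x : ℕ → Y}
    (hx : ∀ n, ‖x n‖ ≤ 1) : SeqContinuous (weakStarFun (weightedEvalSeminorm hx)) := by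
  intro p q hpq
  have hpt := WeakDual.tendsto_iff_forall_apply.1 hpq
  obtain ⟨C, hC0, hC⟩ := exists_norm_le_of_forall_tendsto
    (p := fun n => WeakDual.toStrongDual (p n)) hpt
  refine tendsto_tsum_of_dominated_convergence (summable_geometric_two.mul_right C)
    (fun n => ((hpt (x n)).abs.const_mul _)) (Eventually.of_forall fun k n => ?_)
  rw [Real.norm_of_nonneg (by positivity)]
  gcongr
  exact ((WeakDual.toStrongDual (p k)).le_opNorm _).trans
    ((mul_le_of_le_one_right (norm_nonneg _) (hx n)).trans (hC k))

/-- Along a minimising sequence every evaluation at `x j` tends to `0`, so by compactness each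
ultrafilter limit lies in `K` and is annihilated by all `x j`, hence is `0`. -/
theorem hasStrongMinOn_weightedEvalSeminorm {x : ℕ → Y} (hx : ∀ n, ‖x n‖ ≤ 1)
    {K : Set (StrongDual ℝ Y)} (hK : IsCompact (weakStarSet K)) (h0 : (0 : StrongDual ℝ Y) ∈ K)
    (hsep : ∀ z ∈ K, (∀ n, z (x n) = 0) → z = 0) :
    HasStrongMinOn (weakStarFun (weightedEvalSeminorm hx)) (weakStarSet K) 0 := by
  have hzero : weakStarFun (weightedEvalSeminorm hx) 0 = 0 := map_zero (weightedEvalSeminorm hx)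
  refine ⟨h0, fun q _ => ?_, fun p hp hlim => ?_⟩
  · change weakStarFun (weightedEvalSeminorm hx) 0 ≤ _
    rw [hzero]
    exact apply_nonneg (weightedEvalSeminorm hx) _
  rw [hzero] at hlim
  have hcoord : ∀ j, Tendsto (fun n => p n (x j)) atTop (𝓝 0) := by
    intro j
    refine squeeze_zero_norm (a := fun n => 2 ^ j * weakStarFun (weightedEvalSeminorm hx) (p n))
      (fun n => ?_) (by simpa using hlim.const_mul (2 ^ j))
    have h1 : (1 / 2 : ℝ) ^ j * |p n (x j)| ≤ weakStarFun (weightedEvalSeminorm hx) (p n) :=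
      (summable_weighted_eval hx (WeakDual.toStrongDual (p n))).le_tsum j
        fun n _ => by positivity
    rw [Real.norm_eq_abs]
    calc |p n (x j)| = 2 ^ j * ((1 / 2 : ℝ) ^ j * |p n (x j)|) := by
          rw [← mul_assoc, ← mul_pow]; norm_num
      _ ≤ _ := by gcongr
  rw [tendsto_iff_ultrafilter]
  intro U hU
  obtain ⟨q, hqK, hq⟩ := hK.ultrafilter_le_nhds (U.map p) (by
    rw [le_principal_iff]
    exact Filter.mem_map.2 (Eventually.of_forall hp))
  have hq' : Tendsto p U (𝓝 q) := hq
  have : q = 0 := by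
    refine hsep q hqK fun j => ?_
    exact tendsto_nhds_unique (WeakDual.tendsto_iff_forall_apply.1 hq' (x j))
      ((hcoord j).mono_left hU)
  rwa [this] at hq'

/-- The nonnegative sequences with sum at most one. -/
def subprobabilitySeq : Set (ℕ → ℝ) :=
  {a | (∀ n, 0 ≤ a n) ∧ ∀ N, ∑ n ∈ Finset.range N, a n ≤ 1}

theorem isCompact_subprobabilitySeq : IsCompact subprobabilitySeq := by
  refine (isCompact_univ_pi fun _ : ℕ => isCompact_Icc (a := (0 : ℝ)) (b := 1)).of_isClosed_subset
    ?_ ?_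
  · simp only [subprobabilitySeq, Set.ofPred_and, Set.ofPred_forall]
    refine IsClosed.inter (isClosed_iInter fun n => ?_) (isClosed_iInter fun N => ?_)
    · exact isClosed_le continuous_const (continuous_apply n)
    · exact isClosed_le (continuous_finsetSum _ fun n _ => continuous_apply n) continuous_const
  · intro a ha n _
    refine ⟨ha.1 n, le_trans ?_ (ha.2 (n + 1))⟩
    exact Finset.single_le_sum (fun i _ => ha.1 i) (Finset.self_mem_range_succ n)

theorem convex_subprobabilitySeq : Convex ℝ subprobabilitySeq := by
  intro a ha b hb s t hs ht hst
  refine ⟨fun n => ?_, fun N => ?_⟩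
  · have := ha.1 n
    have := hb.1 n
    simp only [Pi.add_apply, Pi.smul_apply, smul_eq_mul]
    positivity
  · simp only [Pi.add_apply, Pi.smul_apply, smul_eq_mul, Finset.sum_add_distrib, ← Finset.mul_sum]
    calc _ ≤ s * 1 + t * 1 := by gcongr; exacts [ha.2 N, hb.2 N]
      _ = 1 := by linarith

theorem summable_of_mem_subprobabilitySeq {a : ℕ → ℝ} (ha : a ∈ subprobabilitySeq) :
    Summable a := summable_of_sum_range_le ha.1 ha.2

theorem summable_smul_of_mem_subprobabilitySeq {a : ℕ → ℝ} (ha : a ∈ subprobabilitySeq)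
    {p : ℕ → StrongDual ℝ Y} {C : ℝ} (hC : ∀ n, ‖p n‖ ≤ C) : Summable fun n => a n • p n := by
  refine Summable.of_norm_bounded ((summable_of_mem_subprobabilitySeq ha).mul_right C) fun n => ?_
  rw [norm_smul, Real.norm_of_nonneg (ha.1 n)]
  exact mul_le_mul_of_nonneg_left (hC n) (ha.1 n)

/-- The infinite convex combinations of a sequence in the dual and `0`. -/
noncomputable def seqConvexHull (p : ℕ → StrongDual ℝ Y) : Set (StrongDual ℝ Y) :=
  (fun a : ℕ → ℝ => ∑' n, a n • p n) '' subprobabilitySeq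

theorem zero_mem_seqConvexHull (p : ℕ → StrongDual ℝ Y) : 0 ∈ seqConvexHull p :=
  ⟨0, ⟨by simp, by simp⟩, by simp⟩

theorem mem_seqConvexHull (p : ℕ → StrongDual ℝ Y) (k : ℕ) : p k ∈ seqConvexHull p := by
  refine ⟨Pi.single k 1, ⟨fun n => ?_, fun N => ?_⟩, ?_⟩
  · by_cases h : n = k
    · subst h; simp
    · simp [h]
  · simp only [Pi.single_apply, Finset.sum_ite_eq']
    split_ifs <;> simp
  · change ∑' n, (Pi.single k 1 : ℕ → ℝ) n • p n = p k
    rw [tsum_eq_single k]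
    · simp
    · intro n hn
      simp [hn]

theorem convex_seqConvexHull {p : ℕ → StrongDual ℝ Y} {C : ℝ} (hC : ∀ n, ‖p n‖ ≤ C) :
    Convex ℝ (seqConvexHull p) := by
  rintro _ ⟨a, ha, rfl⟩ _ ⟨b, hb, rfl⟩ s t hs ht hst
  refine ⟨s • a + t • b, convex_subprobabilitySeq ha hb hs ht hst, ?_⟩
  have h1 := summable_smul_of_mem_subprobabilitySeq ha hC
  have h2 := summable_smul_of_mem_subprobabilitySeq hb hC
  simp only [Pi.add_apply, Pi.smul_apply, add_smul, smul_assoc]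
  rw [(h1.const_smul s).tsum_add (h2.const_smul t), h1.tsum_const_smul, h2.tsum_const_smul]

theorem seqConvexHull_subset_closure_span {p : ℕ → StrongDual ℝ Y} {C : ℝ}
    (hC : ∀ n, ‖p n‖ ≤ C) :
    seqConvexHull p ⊆ (Submodule.span ℝ (Set.range p)).topologicalClosure := by
  rintro _ ⟨a, ha, rfl⟩
  refine mem_closure_of_tendsto
    (summable_smul_of_mem_subprobabilitySeq ha hC).hasSum.tendsto_sum_nat
    (Eventually.of_forall fun N => ?_)
  exact Submodule.sum_mem _ fun n _ =>
    Submodule.smul_mem _ _ (Submodule.subset_span ⟨n, rfl⟩)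

theorem isSeparable_closure_span_range (p : ℕ → StrongDual ℝ Y) :
    TopologicalSpace.IsSeparable
      ((Submodule.span ℝ (Set.range p)).topologicalClosure : Set (StrongDual ℝ Y)) := by
  rw [Submodule.topologicalClosure_coe]
  exact ((Set.countable_range p).isSeparable.span (R := ℝ)).closure

theorem tsum_smul_apply {p : ℕ → StrongDual ℝ Y} {C : ℝ} (hC : ∀ n, ‖p n‖ ≤ C) {a : ℕ → ℝ}
    (ha : a ∈ subprobabilitySeq) (y : Y) :
    HasSum (fun n => a n * p n y) ((∑' n, a n • p n) y) := by
  simpa using (summable_smul_of_mem_subprobabilitySeq ha hC).hasSum.mapL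
    (ContinuousLinearMap.apply ℝ ℝ y)

/-- Since `p n y → 0` and the weights sum to at most one, the partial sums at `y` converge uniformly
in `a`. This exhibits the hull as a continuous image of a compact set. -/
theorem continuous_tsum_smul {p : ℕ → StrongDual ℝ Y} (hp : IsWeakStarNull p) {C : ℝ}
    (hC : ∀ n, ‖p n‖ ≤ C) :
    Continuous fun a : subprobabilitySeq => StrongDual.toWeakDual (∑' n, a.1 n • p n) := by
  refine WeakDual.continuous_of_continuous_eval fun y => ?_
  have hlim : TendstoUniformly
      (fun N (a : subprobabilitySeq) => ∑ n ∈ Finset.range N, a.1 n * p n y)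
      (fun a => (∑' n, a.1 n • p n) y) atTop := by
    rw [Metric.tendstoUniformly_iff]
    intro ε hε
    have hev := (isWeakStarNull_iff.1 hp y).abs.eventually_le_const
      (show |(0 : ℝ)| < ε / 2 by simpa using half_pos hε)
    obtain ⟨N₀, hN₀⟩ := eventually_atTop.1 hev
    filter_upwards [eventually_ge_atTop N₀] with N hN a
    have hsum := tsum_smul_apply hC a.2 y
    have hle : ∀ M ≥ N, dist (∑ n ∈ Finset.range M, a.1 n * p n y)
        (∑ n ∈ Finset.range N, a.1 n * p n y) ≤ ε / 2 := by
      intro M hM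
      rw [Real.dist_eq, ← Finset.sum_Ico_eq_sub _ hM]
      calc |∑ n ∈ Finset.Ico N M, a.1 n * p n y|
          ≤ ∑ n ∈ Finset.Ico N M, |a.1 n * p n y| := Finset.abs_sum_le_sum_abs _ _
        _ ≤ ∑ n ∈ Finset.Ico N M, a.1 n * (ε / 2) := by
          refine Finset.sum_le_sum fun n hn => ?_
          rw [abs_mul, abs_of_nonneg (a.2.1 n)]
          exact mul_le_mul_of_nonneg_left
            (hN₀ n (hN.trans (Finset.mem_Ico.1 hn).1)) (a.2.1 n)
        _ ≤ ∑ n ∈ Finset.range M, a.1 n * (ε / 2) :=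
          Finset.sum_le_sum_of_subset_of_nonneg
            (fun n hn => Finset.mem_range.2 (Finset.mem_Ico.1 hn).2)
            fun n _ _ => mul_nonneg (a.2.1 n) (half_pos hε).le
        _ ≤ 1 * (ε / 2) := by
          rw [← Finset.sum_mul]
          exact mul_le_mul_of_nonneg_right (a.2.2 M) (half_pos hε).le
        _ = ε / 2 := one_mul _
    refine lt_of_le_of_lt ?_ (half_lt_self hε)
    exact le_of_tendsto (hsum.tendsto_sum_nat.dist tendsto_const_nhds)
      ((eventually_ge_atTop N).mono hle)
  refine hlim.continuous (Eventually.of_forall fun N => ?_).frequently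
  exact continuous_finsetSum _ fun n _ =>
    ((continuous_apply n).comp continuous_subtype_val).mul continuous_const

theorem isCompact_weakStarSet_seqConvexHull {p : ℕ → StrongDual ℝ Y} (hp : IsWeakStarNull p)
    {C : ℝ} (hC : ∀ n, ‖p n‖ ≤ C) : IsCompact (weakStarSet (seqConvexHull p)) := by
  have : CompactSpace subprobabilitySeq := isCompact_iff_compactSpace.1 isCompact_subprobabilitySeq
  convert isCompact_range (continuous_tsum_smul hp hC) using 1
  ext q
  constructor
  · rintro ⟨a, ha, hq⟩
    exact ⟨⟨a, ha⟩, hq⟩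
  · rintro ⟨a, rfl⟩
    exact ⟨a, a.2, rfl⟩

theorem metrizableSpace_weakStarSet_of_separating {K : Set (StrongDual ℝ Y)}
    (hK : IsCompact (weakStarSet K)) {Z : Submodule ℝ (StrongDual ℝ Y)} (hKZ : K ⊆ Z) {x : ℕ → Y}
    (hsep : ∀ z ∈ Z, (∀ n, z (x n) = 0) → z = 0) :
    TopologicalSpace.MetrizableSpace (weakStarSet K) := by
  have : CompactSpace (weakStarSet K) := isCompact_iff_compactSpace.1 hK
  refine Metric.PiNatEmbed.TopologicalSpace.MetrizableSpace.of_countable_separating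
    (fun n (q : weakStarSet K) => q.1 (x n))
    (fun n => (WeakDual.eval_continuous (x n)).comp continuous_subtype_val) ?_
  intro q q' hne
  contrapose! hne
  refine Subtype.ext (WeakDual.toStrongDual.injective (sub_eq_zero.1 ?_))
  exact hsep _ (Z.sub_mem (hKZ q.2) (hKZ q'.2)) fun n => sub_eq_zero.2 (hne n)

theorem IsJNSequence.exists_weakStar_strong_min [CompleteSpace Y] {p : ℕ → StrongDual ℝ Y}
    (hp : IsJNSequence p) :
    ∃ (K : Set (StrongDual ℝ Y)) (h : Seminorm ℝ (StrongDual ℝ Y)),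
        Convex ℝ K ∧ TopologicalSpace.IsSeparable K ∧ (0 : StrongDual ℝ Y) ∈ K ∧
        IsCompact (weakStarSet K) ∧ TopologicalSpace.MetrizableSpace (weakStarSet K) ∧
        Continuous h ∧ LowerSemicontinuous (weakStarFun h) ∧ SeqContinuous (weakStarFun h) ∧
        HasStrongMinOn (weakStarFun h) (weakStarSet K) 0 ∧ ¬ HasStrongMinOn h K 0 := by
  obtain ⟨C, -, hC⟩ := exists_norm_le_of_forall_tendsto (isWeakStarNull_iff.1 hp.1)
  have hsub := seqConvexHull_subset_closure_span hC
  have hZ := isSeparable_closure_span_range p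
  obtain ⟨x, hx, hsep⟩ := exists_seq_separating_of_isSeparable hZ
  have hcpt := isCompact_weakStarSet_seqConvexHull hp.1 hC
  have hseq := seqContinuous_weightedEvalSeminorm hx
  refine ⟨seqConvexHull p, weightedEvalSeminorm hx, convex_seqConvexHull hC, hZ.mono hsub,
    zero_mem_seqConvexHull p, hcpt, metrizableSpace_weakStarSet_of_separating hcpt hsub hsep,
    continuous_weightedEvalSeminorm hx, lowerSemicontinuous_weightedEvalSeminorm hx, hseq,
    hasStrongMinOn_weightedEvalSeminorm hx hcpt (zero_mem_seqConvexHull p)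
      fun z hz => hsep z (hsub hz), fun hmin => ?_⟩
  -- The sequence `p` itself minimises the seminorm on `K` but is bounded away from `0` in norm.
  exact hp.not_tendsto_zero (hmin.2.2 p (mem_seqConvexHull p) (hseq hp.1))

end

/-! ### Assembling the equivalences. -/

theorem theorem1p2 (Y : Type u) [NormedAddCommGroup Y] [NormedSpace ℝ Y] [CompleteSpace Y] :
    List.TFAE [
      ¬ FiniteDimensional ℝ Y,
      ∃ p : ℕ → StrongDual ℝ Y, IsJNSequence p,
      ∃ (K : Set (StrongDual ℝ Y)) (h : Seminorm ℝ (StrongDual ℝ Y)),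
        Convex ℝ K ∧ TopologicalSpace.IsSeparable K ∧ (0 : StrongDual ℝ Y) ∈ K ∧
        IsCompact (weakStarSet K) ∧ TopologicalSpace.MetrizableSpace (weakStarSet K) ∧
        Continuous h ∧ LowerSemicontinuous (weakStarFun h) ∧ SeqContinuous (weakStarFun h) ∧
        HasStrongMinOn (weakStarFun h) (weakStarSet K) 0 ∧ ¬ HasStrongMinOn h K 0,
      ∃ (X : Type (max u v)) (_ : NormedAddCommGroup X) (_ : NormedSpace ℝ X)
        (_ : CompleteSpace X) (T : Y →L[ℝ] X), ¬ IsLimitedOperator T,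
      ∃ f : Y → ℝ, ConvexOn ℝ Set.univ f ∧ Continuous f ∧ IsPGNF f] := by
  tfae_have 1 → 2 := exists_isJNSequence_of_not_finiteDimensional
  tfae_have 2 → 3 := fun ⟨_, hp⟩ => hp.exists_weakStar_strong_min
  tfae_have 3 → 1 := fun ⟨_, _, _, _, _, _, _, _, _, _, hw, hn⟩ _ => hn hw.of_weakStar
  tfae_have 2 → 4 := fun ⟨_, hp⟩ =>
    -- The operator is the identity of `Y`, lifted to the universe required of `X`.
    ⟨ULift.{v} Y, inferInstance, inferInstance, inferInstance, _,
      hp.not_isLimitedOperator ContinuousLinearEquiv.ulift.symm⟩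
  tfae_have 4 → 1 := fun ⟨_, _, _, _, T, hT⟩ _ => hT (isLimitedOperator_of_finiteDimensional T)
  tfae_have 2 → 5 := by
    rintro ⟨p, hp⟩
    obtain ⟨C, -, hC⟩ := exists_norm_le_of_forall_tendsto (isWeakStarNull_iff.1 hp.1)
    exact ⟨supTruncated p, convexOn_supTruncated hC, continuous_supTruncated hC, 0,
      ⟨0, hasLineDerivAt_supTruncated hp.1 hC⟩, not_differentiableAt_supTruncated hp hC⟩
  tfae_have 5 → 1 := fun ⟨_, hf, _, _, hG, hF⟩ _ =>
    hF (hf.differentiableAt_of_gateauxDifferentiableAt hG)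
  tfae_finish
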